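/- Identify $\mathbb{R}^2$ with $\mathbb{C}$. Let $\mathcal{H}^1$ and $\dim$ denote 1-dimensional Hausdorff measure and Hausdorff dimension. A set $A \subset \mathbb{C}$ is 1-rectifiable if there are countably many Lipschitz maps $g_i : \mathbb{R} \to \mathbb{C}$ with $\mathcal{H}^1(A \setminus \bigcup_i g_i(\mathbb{R})) = 0$. For $\Gamma \subset \mathbb{C}$, a $\Gamma$-Besicovitch set is a set $B \subset \mathbb{C}$ such that for every $\theta \in \mathbb{R}$ there is $v \in \mathbb{C}$ with $e^{i\theta}\Gamma + v \subset B$. A Cantor set is a nonempty, compact, perfect, totally disconnected subset of $\mathbb{R}$. A line $V$ through the origin is the (approximate) tangent direction of $\Gamma$ at $p$ if $\limsup_{r \to 0^+} \mathcal{H}^1(\Gamma \cap \overline{B}(p,r))/(2r) > 0$ and, for every $0<t<1$, $r^{-1}\,\mathcal{H}^1\big(\{x \in \Gamma \cap \overline{B}(p,r) : \operatorname{dist}(x-p,V) \ge t|x-p|\}\big) \to 0$ as $r \to 0^+$. Theorem. For every $s \in [0,1]$ there exists a 1-rectifiable set $\Gamma \subset \mathbb{C}$ with the following properties. (i) $\mathcal{H}^1(\Gamma)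 > 0$. (ii) There exists a $\Gamma$-Besicovitch set $B$ with $\dim B = 1$. (iii) $\Gamma$ is the graph $\{x + i f(x) : x \in C\}$ of a monotone (nondecreasing) function $f : C \to \mathbb{R}$ whose domain $C \subset \mathbb{R}$ is a Cantor set of Lebesgue measure $0$ and Hausdorff dimension $s$, and at $\mathcal{H}^1$-almost every point of $\Gamma$ the tangent of $\Gamma$ is vertical. -/

import Mathlib

open MeasureTheory Set Filter
open scoped Topology MeasureTheory

/-- A set `C ⊆ ℝ` is a Cantor set: nonempty, compact, perfect (closed, without isolated points)
and totally disconnected. -/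
def IsCantorSet (C : Set ℝ) : Prop :=
  C.Nonempty ∧ IsCompact C ∧ Perfect C ∧ IsTotallyDisconnected C

/-- The graph over `C ⊆ ℝ` of `f`, in the plane `ℂ ≅ ℝ²` (only the values of `f` on `C`
matter). -/
def planeGraphOn (C : Set ℝ) (f : ℝ → ℝ) : Set ℂ :=
  {z : ℂ | z.re ∈ C ∧ z.im = f z.re}

/-- `A` is 1-rectifiable: `ℋ¹`-almost all of `A` is covered by countably many Lipschitz images
of the real line. -/
def IsOneRectifiable (A : Set ℂ) : Prop :=
  ∃ g : ℕ → ℝ → ℂ, (∀ i, ∃ K : NNReal, LipschitzWith K (g i)) ∧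
    μH[1] (A \ ⋃ i, range (g i)) = 0

/-- The upper 1-dimensional density of `A` at `a`. -/
noncomputable def upperDensityOne (A : Set ℂ) (a : ℂ) : ENNReal :=
  limsup (fun r : ℝ => μH[1] (A ∩ Metric.closedBall a r) / ENNReal.ofReal (2 * r)) (𝓝[>] 0)

/-- The open double cone with vertex `a`, axis `a + V` and opening parameter `t`. -/
def doubleCone (a : ℂ) (V : Submodule ℝ ℂ) (t : ℝ) : Set ℂ :=
  {x : ℂ | Metric.infDist (x - a) (V : Set ℂ) < t * ‖x - a‖}

/-- The line with direction `V` is the (approximate) tangent of `A` at `a`: `A` has positive upper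
density at `a`, and for every opening `0 < t < 1` the part of `A` near `a` outside the double cone
around `a + V` has `ℋ¹`-measure `o(r)` in the ball of radius `r`. -/
def IsApproxTangentLine (A : Set ℂ) (a : ℂ) (V : Submodule ℝ ℂ) : Prop :=
  Module.finrank ℝ V = 1 ∧ 0 < upperDensityOne A a ∧
    ∀ t : ℝ, 0 < t → t < 1 →
      Tendsto (fun r : ℝ =>
          μH[1] ((A ∩ Metric.closedBall a r) \ doubleCone a V t) / ENNReal.ofReal r)
        (𝓝[>] 0) (𝓝 0)

/-- The direction of the vertical lines in `ℂ ≅ ℝ²`. -/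
noncomputable def verticalDirection : Submodule ℝ ℂ := Submodule.span ℝ {Complex.I}

/-- `B` is a `Γ`-Besicovitch set: for every angle `θ`, it contains a translate of `Γ` rotated
by `θ`. -/
def IsBesicovitchSetFor (Γ B : Set ℂ) : Prop :=
  ∀ θ : ℝ, ∃ v : ℂ, (fun z : ℂ => Complex.exp (θ * Complex.I) * z + v) '' Γ ⊆ B

/-! Points of Γ are coded by binary sequences. If `u ∈ [0,1]` is the number with these digits, the
point `z` satisfies `|z|² = 1 + u`, and its abscissa `x` is obtained by multiplying the block of
digits with places in `[q n, q (n+1))` by a slope `σ n = 2^-(p n + 1)`. The modulus already sends Γ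
onto `[1, √2]`, so `ℋ¹(Γ) > 0`. As `u` is nondecreasing in `x` and `x ∈ [-1/2, 0]`, the ordinate
`√(1 + u - x²)` is nondecreasing in `x`.

For the real centre `c n = 2^(p n)` one has `2 c n σ n = 1`, hence `|z - c n|² = c n² + 1 - 2 c n (x
- σ n u)`. Once the first `q n` digits are fixed, `x - σ n u` varies by at most `σ n 2^-q(n+1)`
(`abs_abscissa_sub_mul_ofDigits_sub_le`), so this piece of Γ lies within about `2^-q(n+1)` of a
circle about `c n`, and rotating it about `c n` sweeps almost no area. The translation `angleShift`
makes the copies with angle in a short dyadic interval turn about almost the same point, at every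
stage simultaneously. Each such family is then covered by about `2^(p n + q(n+1))` sets of diameter
`O(2^-q(n+1))` (`dist_besicovitchPoint_le`). If `q (n+1)` is huge compared with `p n + q n + n`, the
number of families does not matter and the union has dimension 1.

The domain splits into `2^(q n)` pieces of diameter at most `2^-(p n + q n + 1)`, while `u` is a
Hölder function of `x` onto `[0,1]`. Choosing `q n / (p n + q n) → s` thus gives dimension `s`; when
`s = 0` the positive targets `stageDim` tend to 0.

Rectifiability and tangents hold for more general monotone graphs: `Re + Im` has a 1-Lipschitz
inverse on the graph, and over a null domain the abscissa has derivative zero almost everywhere in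
this parameter. -/

/-! ### Covering and differentiation tools -/

/-- A parametrised set which, at every stage `n`, splits into finitely many classes of diameter at
most `r n` is `μH[d]`-null if the number of classes times `r n ^ d` tends to zero. -/
theorem hausdorffMeasure_range_eq_zero_of_classes {X P : Type*} [MetricSpace X]
    [MeasurableSpace X] [BorelSpace X] (F : P → X) {d : ℝ} (hd : 0 ≤ d) (ι : ℕ → Type)
    [∀ n, Fintype (ι n)] (κ : ∀ n, P → ι n) (r : ℕ → ℝ) (hr0 : ∀ n, 0 ≤ r n)
    (hr : Tendsto r atTop (𝓝 0))
    (h : ∀ n a b, κ n a = κ n b → dist (F a) (F b) ≤ r n)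
    (hlim : Tendsto (fun n => (Fintype.card (ι n) : ℝ) * r n ^ d) atTop (𝓝 0)) :
    μH[d] (range F) = 0 := by
  have hdiam : ∀ n i, Metric.ediam (F '' (κ n ⁻¹' {i})) ≤ ENNReal.ofReal (r n) := by
    intro n i
    apply Metric.ediam_le
    rintro _ ⟨a, ha, rfl⟩ _ ⟨b, hb, rfl⟩
    rw [edist_dist]
    exact ENNReal.ofReal_le_ofReal (h n a b (by simp_all))
  have key := Measure.hausdorffMeasure_le_liminf_sum d (range F) (l := atTop)
    (fun n => ENNReal.ofReal (r n)) (by simpa using ENNReal.tendsto_ofReal hr)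
    (fun n i => F '' (κ n ⁻¹' {i})) (Eventually.of_forall hdiam)
    (Eventually.of_forall fun n => by
      rintro _ ⟨a, rfl⟩
      exact mem_iUnion.2 ⟨κ n a, a, rfl, rfl⟩)
  refine le_antisymm (key.trans ?_) bot_le
  have hlim' := ENNReal.tendsto_ofReal hlim
  rw [ENNReal.ofReal_zero] at hlim'
  rw [← hlim'.liminf_eq]
  refine liminf_le_liminf (Eventually.of_forall fun n => ?_)
  calc ∑ i, Metric.ediam (F '' (κ n ⁻¹' {i})) ^ d
      ≤ ∑ _i : ι n, ENNReal.ofReal (r n) ^ d :=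
        Finset.sum_le_sum fun i _ => ENNReal.rpow_le_rpow (hdiam n i) hd
    _ = ENNReal.ofReal ((Fintype.card (ι n) : ℝ) * r n ^ d) := by
        rw [ENNReal.ofReal_mul (by positivity), ENNReal.ofReal_rpow_of_nonneg (hr0 n) hd]
        simp

/-- An injective monotone function on a measurable set with null image has derivative zero at
almost every point of the set. -/
theorem MonotoneOn.ae_hasDerivWithinAt_zero {S : Set ℝ} (hS : MeasurableSet S) {X : ℝ → ℝ}
    (hX : MonotoneOn X S) (hinj : InjOn X S) (h0 : volume (X '' S) = 0) :
    ∀ᵐ t, t ∈ S → HasDerivWithinAt X 0 S t := by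
  have hdiff := hX.ae_differentiableWithinAt_of_mem
  have hnull : NullMeasurableSet {t ∈ S | DifferentiableWithinAt ℝ X S t} volume := by
    refine hS.nullMeasurableSet.congr ?_
    filter_upwards [hdiff] with t ht
    exact propext ⟨fun h => ⟨h, ht h⟩, fun h => h.1⟩
  -- The area formula needs a measurable set on which the derivative exists everywhere. There it
  -- equates the integral of `|X'|` with the measure of the image, which is zero.
  obtain ⟨S', hS'sub, hS', hae⟩ := hnull.exists_measurable_subset_ae_eq
  have hder : ∀ t ∈ S', HasDerivWithinAt X (derivWithin X S t) S' t := fun t ht =>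
    (hS'sub ht).2.hasDerivWithinAt.mono fun u hu => (hS'sub hu).1
  have hint := lintegral_abs_det_fderiv_eq_addHaar_image volume hS'
    (fun t ht => (hder t ht).hasFDerivWithinAt) (hinj.mono fun u hu => (hS'sub hu).1)
  have hmeas := aemeasurable_ofReal_abs_det_fderivWithin volume hS'
    (fun t ht => (hder t ht).hasFDerivWithinAt)
  rw [measure_mono_null (image_mono fun u hu => (hS'sub hu).1) h0,
    lintegral_eq_zero_iff' hmeas] at hint
  have hint' := (ae_restrict_iff' hS').1 hint
  filter_upwards [hint', hdiff, hae] with t h1 h2 h3 ht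
  have htS' : t ∈ S' := by
    have : (t ∈ S') = (t ∈ {t ∈ S | DifferentiableWithinAt ℝ X S t}) := h3
    rw [this]
    exact ⟨ht, h2 ht⟩
  have hz := h1 htS'
  simp only [ContinuousLinearMap.det_toSpanSingleton, Pi.zero_apply,
    ENNReal.ofReal_eq_zero, abs_nonpos_iff] at hz
  rw [← hz]
  exact (h2 ht).hasDerivWithinAt

/-! ### Monotone graphs: rectifiability and vertical tangents -/

namespace planeGraphOn

variable {C : Set ℝ} {f : ℝ → ℝ}

/-- On a monotone graph the increments of `Re` and `Im` have the same sign, so the increment of `Re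
+ Im` has modulus `|Δ Re| + |Δ Im|`. -/
theorem abs_sub_le (hf : MonotoneOn f C) {z w : ℂ} (hz : z ∈ planeGraphOn C f)
    (hw : w ∈ planeGraphOn C f) :
    |z.re - w.re| ≤ |z.re + z.im - (w.re + w.im)| ∧
      dist z w ≤ |z.re + z.im - (w.re + w.im)| := by
  wlog h : w.re ≤ z.re generalizing z w
  · have := this hw hz (le_of_not_ge h)
    rwa [abs_sub_comm z.re, dist_comm, abs_sub_comm (z.re + z.im)]
  have him : w.im ≤ z.im := by
    rw [hz.2, hw.2]; exact hf hw.1 hz.1 h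
  rw [abs_of_nonneg (by linarith), abs_of_nonneg (by linarith)]
  refine ⟨by linarith, ?_⟩
  rw [Complex.dist_eq]
  refine (Complex.norm_le_abs_re_add_abs_im _).trans ?_
  rw [Complex.sub_re, Complex.sub_im, abs_of_nonneg (by linarith), abs_of_nonneg (by linarith)]
  linarith

/-- The inverse of `z ↦ Re z + Im z` on the graph. -/
noncomputable def param (C : Set ℝ) (f : ℝ → ℝ) : ℝ → ℂ :=
  Function.invFunOn (fun z : ℂ => z.re + z.im) (planeGraphOn C f)

theorem param_mem {t : ℝ} (ht : t ∈ (fun z : ℂ => z.re + z.im) '' planeGraphOn C f) :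
    param C f t ∈ planeGraphOn C f ∧ (param C f t).re + (param C f t).im = t :=
  ⟨Function.invFunOn_mem ht, Function.invFunOn_eq ht⟩

theorem param_apply (hf : MonotoneOn f C) {z : ℂ} (hz : z ∈ planeGraphOn C f) :
    param C f (z.re + z.im) = z := by
  have h := param_mem (C := C) (f := f) ⟨z, hz, rfl⟩
  have := (abs_sub_le hf h.1 hz).2
  rw [h.2, sub_self, abs_zero] at this
  exact dist_le_zero.1 this

theorem lipschitzOnWith_param (hf : MonotoneOn f C) :
    LipschitzOnWith 1 (param C f) ((fun z : ℂ => z.re + z.im) '' planeGraphOn C f) := by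
  refine LipschitzOnWith.of_dist_le_mul fun s hs t ht => ?_
  have h1 := param_mem hs
  have h2 := param_mem ht
  have := (abs_sub_le hf h1.1 h2.1).2
  rw [h1.2, h2.2] at this
  simpa [Real.dist_eq] using this

theorem isOneRectifiable (hf : MonotoneOn f C) : IsOneRectifiable (planeGraphOn C f) := by
  have hL := lipschitzOnWith_param hf
  have hre : LipschitzOnWith 1 (fun t => (param C f t).re)
      ((fun z : ℂ => z.re + z.im) '' planeGraphOn C f) := by
    refine LipschitzOnWith.of_dist_le_mul fun s hs t ht => ?_
    refine le_trans ?_ (hL.dist_le_mul s hs t ht)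
    rw [Real.dist_eq, Complex.dist_eq, ← Complex.sub_re]
    exact Complex.abs_re_le_norm _
  have him : LipschitzOnWith 1 (fun t => (param C f t).im)
      ((fun z : ℂ => z.re + z.im) '' planeGraphOn C f) := by
    refine LipschitzOnWith.of_dist_le_mul fun s hs t ht => ?_
    refine le_trans ?_ (hL.dist_le_mul s hs t ht)
    rw [Real.dist_eq, Complex.dist_eq, ← Complex.sub_im]
    exact Complex.abs_im_le_norm _
  obtain ⟨g, hg, hgeq⟩ := hre.extend_real
  obtain ⟨k, hk, hkeq⟩ := him.extend_real
  refine ⟨fun _ t => ⟨g t, k t⟩, fun _ => ⟨2, LipschitzWith.of_dist_le_mul fun s t => ?_⟩, ?_⟩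
  · have h1 := hg.dist_le_mul s t
    have h2 := hk.dist_le_mul s t
    rw [Complex.dist_eq]
    refine (Complex.norm_le_abs_re_add_abs_im _).trans ?_
    simp only [Complex.sub_re, Complex.sub_im, NNReal.coe_one, one_mul, NNReal.coe_ofNat] at *
    rw [Real.dist_eq] at h1 h2
    linarith
  · convert measure_empty (μ := (μH[1] : Measure ℂ))
    refine Set.sdiff_eq_empty.2 fun z hz => mem_iUnion.2 ⟨0, z.re + z.im, ?_⟩
    have h1 := hgeq ⟨z, hz, rfl⟩
    have h2 := hkeq ⟨z, hz, rfl⟩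
    simp only [param_apply hf hz] at h1 h2
    exact Complex.ext h1.symm h2.symm

theorem infDist_verticalDirection_le (z : ℂ) :
    Metric.infDist z (verticalDirection : Set ℂ) ≤ |z.re| := by
  have hmem : ((z.im : ℂ) * Complex.I) ∈ (verticalDirection : Set ℂ) := by
    refine Submodule.mem_span_singleton.2 ⟨z.im, ?_⟩
    simp
  refine (Metric.infDist_le_dist_of_mem hmem).trans ?_
  rw [Complex.dist_eq]
  refine (Complex.norm_le_abs_re_add_abs_im _).trans ?_
  simp

/-- At a point of the graph whose parameter is a density point, and at which the abscissa has
derivative zero with respect to the parameter, the tangent is vertical. -/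
theorem isApproxTangentLine_of_hasDerivWithinAt (hf : MonotoneOn f C) {p : ℂ}
    (hp : p ∈ planeGraphOn C f)
    (hder : HasDerivWithinAt (fun t => (param C f t).re) 0
      ((fun z : ℂ => z.re + z.im) '' planeGraphOn C f) (p.re + p.im))
    (hdens : Tendsto (fun r => volume (((fun z : ℂ => z.re + z.im) '' planeGraphOn C f) ∩
      Metric.closedBall (p.re + p.im) r) / volume (Metric.closedBall (p.re + p.im) r))
      (𝓝[>] 0) (𝓝 1)) :
    IsApproxTangentLine (planeGraphOn C f) p verticalDirection := by
  have hσ : ∀ z w : ℂ, |z.re + z.im - (w.re + w.im)| ≤ 2 * dist z w := by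
    intro z w
    rw [Complex.dist_eq]
    have h1 := Complex.abs_re_le_norm (z - w)
    have h2 := Complex.abs_im_le_norm (z - w)
    rw [Complex.sub_re] at h1
    rw [Complex.sub_im] at h2
    calc |z.re + z.im - (w.re + w.im)| = |(z.re - w.re) + (z.im - w.im)| := by ring_nf
      _ ≤ |z.re - w.re| + |z.im - w.im| := abs_add_le _ _
      _ ≤ _ := by linarith
  refine ⟨finrank_span_singleton Complex.I_ne_zero, ?_, fun t ht0 ht1 => ?_⟩
  · have hlow : ∀ r : ℝ, 0 < r → volume (((fun z : ℂ => z.re + z.im) '' planeGraphOn C f) ∩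
        Metric.closedBall (p.re + p.im) r) ≤ 2 * μH[1] (planeGraphOn C f ∩
          Metric.closedBall p r) := by
      intro r hr
      have hlip : LipschitzWith 2 (fun z : ℂ => z.re + z.im) :=
        LipschitzWith.of_dist_le_mul fun z w => by
          rw [Real.dist_eq]; exact hσ z w
      have := hlip.hausdorffMeasure_image_le (d := 1) zero_le_one
        (planeGraphOn C f ∩ Metric.closedBall p r)
      rw [hausdorffMeasure_real] at this
      simp only [ENNReal.coe_ofNat, ENNReal.rpow_one] at this
      refine le_trans (measure_mono ?_) this
      rintro _ ⟨⟨z, hz, rfl⟩, hzr⟩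
      refine ⟨z, ⟨hz, ?_⟩, rfl⟩
      rw [Metric.mem_closedBall, Real.dist_eq] at hzr
      exact (abs_sub_le hf hz hp).2.trans hzr
    have hev : ∀ᶠ r in 𝓝[>] (0 : ℝ), (4 : ENNReal)⁻¹ ≤
        μH[1] (planeGraphOn C f ∩ Metric.closedBall p r) / ENNReal.ofReal (2 * r) := by
      have hhalf : ∀ᶠ r in 𝓝[>] (0 : ℝ), (2 : ENNReal)⁻¹ <
          volume (((fun z : ℂ => z.re + z.im) '' planeGraphOn C f) ∩
            Metric.closedBall (p.re + p.im) r) / volume (Metric.closedBall (p.re + p.im) r) :=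
        hdens.eventually (lt_mem_nhds (by simp))
      filter_upwards [hhalf, self_mem_nhdsWithin] with r hr hr0
      have hr0 : 0 < r := hr0
      rw [Real.volume_closedBall] at hr
      have h2 := hr.le.trans (ENNReal.div_le_div_right (hlow r hr0) _)
      rw [mul_div_assoc] at h2
      calc (4 : ENNReal)⁻¹ = 2⁻¹ * 2⁻¹ := by
            rw [← ENNReal.mul_inv (by simp) (by simp)]; norm_num
        _ ≤ 2⁻¹ * (2 * (μH[1] (planeGraphOn C f ∩ Metric.closedBall p r) /
              ENNReal.ofReal (2 * r))) := by gcongr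
        _ = _ := by rw [← mul_assoc, ENNReal.inv_mul_cancel (by simp) (by simp), one_mul]
    exact lt_of_lt_of_le (by simp) (le_limsup_of_frequently_le' hev.frequently)
  · rw [hasDerivWithinAt_iff_isLittleO] at hder
    -- Since `Re + Im` is 2-Lipschitz, the constant `t / 4` gives `|Re (z - p)| ≤ (t / 2) ‖z - p‖`.
    -- All points of the graph near `p`, except `p`, then lie in the cone. The radius `δ / 2` below
    -- absorbs the same factor 2.
    have hev := hder.bound (c := t / 4) (by positivity)
    rw [eventually_nhdsWithin_iff, Metric.eventually_nhds_iff] at hev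
    obtain ⟨δ, hδ, hev⟩ := hev
    refine tendsto_const_nhds.congr' ?_
    have hsmall : Ioo (0 : ℝ) (δ / 2) ∈ 𝓝[>] (0 : ℝ) := Ioo_mem_nhdsGT (by positivity)
    filter_upwards [hsmall] with r hr
    have hsub : (planeGraphOn C f ∩ Metric.closedBall p r) \ doubleCone p verticalDirection t ⊆
        {p} := by
      rintro z ⟨⟨hz, hzr⟩, hcone⟩
      by_contra hne
      refine hcone ?_
      have hpos : 0 < ‖z - p‖ := norm_pos_iff.2 (sub_ne_zero.2 hne)
      have h1 := hσ z p
      rw [Metric.mem_closedBall] at hzr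
      have h2 := hev (y := z.re + z.im) (by rw [Real.dist_eq]; linarith [hr.2]) ⟨z, hz, rfl⟩
      simp only [param_apply hf hz, param_apply hf hp, smul_zero, sub_zero,
        Real.norm_eq_abs] at h2
      rw [Complex.dist_eq] at h1
      have h3 := infDist_verticalDirection_le (z - p)
      rw [Complex.sub_re] at h3
      show Metric.infDist (z - p) _ < t * ‖z - p‖
      have h4 : t / 4 * |z.re + z.im - (p.re + p.im)| ≤ t / 4 * (2 * ‖z - p‖) := by gcongr
      nlinarith [mul_pos ht0 hpos]
    have : NullSingletonClass (μH[1] : Measure ℂ) :=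
      Measure.nullSingletonClass_hausdorff ℂ zero_lt_one
    rw [measure_mono_null hsub (measure_singleton p), ENNReal.zero_div]

/-- A compact graph of a monotone function over a null set has a vertical tangent almost
everywhere. -/
theorem ae_isApproxTangentLine (hf : MonotoneOn f C) (hC : volume C = 0)
    (hcomp : IsCompact (planeGraphOn C f)) :
    ∀ᵐ p ∂(μH[1] : Measure ℂ), p ∈ planeGraphOn C f →
      IsApproxTangentLine (planeGraphOn C f) p verticalDirection := by
  have hS : MeasurableSet ((fun z : ℂ => z.re + z.im) '' planeGraphOn C f) :=
    (hcomp.image (by fun_prop)).measurableSet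
  have hmono : MonotoneOn (fun t => (param C f t).re)
      ((fun z : ℂ => z.re + z.im) '' planeGraphOn C f) := by
    rintro _ ⟨z, hz, rfl⟩ _ ⟨w, hw, rfl⟩ hzw
    simp only [param_apply hf hz, param_apply hf hw] at *
    by_contra hlt
    push Not at hlt
    -- If the abscissas were in the wrong strict order, monotonicity would put the sums `Re + Im` in
    -- the wrong strict order too.
    have := hf hw.1 hz.1 hlt.le
    rw [← hz.2, ← hw.2] at this
    linarith
  have hinj : InjOn (fun t => (param C f t).re)
      ((fun z : ℂ => z.re + z.im) '' planeGraphOn C f) := by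
    rintro _ ⟨z, hz, rfl⟩ _ ⟨w, hw, rfl⟩ hzw
    simp only [param_apply hf hz, param_apply hf hw] at *
    rw [hz.2, hw.2, hzw]
  have hnull : volume ((fun t => (param C f t).re) ''
      ((fun z : ℂ => z.re + z.im) '' planeGraphOn C f)) = 0 := by
    refine measure_mono_null ?_ hC
    rintro _ ⟨_, ⟨z, hz, rfl⟩, rfl⟩
    simpa only [param_apply hf hz] using hz.1
  have h1 := hmono.ae_hasDerivWithinAt_zero hS hinj hnull
  have h2 := (ae_restrict_iff' hS).1 (Besicovitch.ae_tendsto_measure_inter_div volume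
    ((fun z : ℂ => z.re + z.im) '' planeGraphOn C f))
  have hboth := h1.and h2
  set S := (fun z : ℂ => z.re + z.im) '' planeGraphOn C f with hSdef
  set N := {t | ¬((t ∈ S → HasDerivWithinAt (fun t => (param C f t).re) 0 S t) ∧
    (t ∈ S → Tendsto (fun r => volume (S ∩ Metric.closedBall t r) /
      volume (Metric.closedBall t r)) (𝓝[>] 0) (𝓝 1)))} with hN
  have hN0 : volume (S ∩ N) = 0 := measure_mono_null inter_subset_right hboth
  have himg : μH[1] (param C f '' (S ∩ N)) = 0 := by
    have := ((lipschitzOnWith_param hf).mono inter_subset_left).hausdorffMeasure_image_le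
      (s := S ∩ N) (d := 1) zero_le_one
    rw [hausdorffMeasure_real, hN0, mul_zero] at this
    exact le_antisymm this bot_le
  refine measure_mono_null ?_ himg
  intro p hp
  by_contra hpn
  refine hp fun hpG => ?_
  have hpS : p.re + p.im ∈ S := ⟨p, hpG, rfl⟩
  have : p.re + p.im ∉ N := fun hpN => hpn ⟨p.re + p.im, ⟨hpS, hpN⟩, param_apply hf hpG⟩
  rw [hN, mem_ofPred_eq, not_not] at this
  exact isApproxTangentLine_of_hasDerivWithinAt hf hpG (this.1 hpS) (this.2 hpS)

end planeGraphOn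

/-! ### Binary truncations -/

/-- The number given by the first `m` binary digits of `b`. -/
noncomputable def binaryTrunc (m : ℕ) (b : ℕ → Fin 2) : ℝ :=
  ∑ i ∈ Finset.range m, Real.ofDigitsTerm b i

theorem binaryTrunc_mono (b : ℕ → Fin 2) : Monotone fun m => binaryTrunc m b := fun _ _ h =>
  Finset.sum_le_sum_of_subset_of_nonneg (Finset.range_subset_range.2 h)
    fun _ _ _ => Real.ofDigitsTerm_nonneg

theorem binaryTrunc_le (m : ℕ) (b : ℕ → Fin 2) : binaryTrunc m b ≤ Real.ofDigits b := by
  rw [Real.ofDigits_eq_sum_add_ofDigits b m]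
  have := Real.ofDigits_nonneg (fun i => b (i + m))
  have h2 : (0 : ℝ) ≤ (((2 : ℕ) : ℝ) ^ m)⁻¹ := by positivity
  unfold binaryTrunc
  nlinarith

theorem ofDigits_sub_binaryTrunc_le (m : ℕ) (b : ℕ → Fin 2) :
    Real.ofDigits b - binaryTrunc m b ≤ ((2 : ℝ) ^ m)⁻¹ := by
  rw [Real.ofDigits_eq_sum_add_ofDigits b m]
  have := Real.ofDigits_le_one (fun i => b (i + m))
  have h2 : (0 : ℝ) ≤ ((2 : ℝ) ^ m)⁻¹ := by positivity
  unfold binaryTrunc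
  push_cast
  nlinarith

theorem binaryTrunc_mul_pow (m : ℕ) (b : ℕ → Fin 2) : ∃ D : ℕ, binaryTrunc m b * 2 ^ m = D := by
  induction m with
  | zero => exact ⟨0, by simp [binaryTrunc]⟩
  | succ m ih =>
    obtain ⟨D, hD⟩ := ih
    refine ⟨2 * D + b m, ?_⟩
    rw [binaryTrunc, Finset.sum_range_succ, ← binaryTrunc, Real.ofDigitsTerm]
    push_cast
    rw [← hD]
    field_simp
    ring

theorem binaryTrunc_congr {m : ℕ} {b b' : ℕ → Fin 2} (h : ∀ i < m, b i = b' i) {k : ℕ}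
    (hk : k ≤ m) : binaryTrunc k b = binaryTrunc k b' :=
  Finset.sum_congr rfl fun i hi => by
    rw [Real.ofDigitsTerm, Real.ofDigitsTerm, h i ((Finset.mem_range.1 hi).trans_le hk)]

/-- Both truncations are integer multiples of `2^-m`. -/
theorem binaryTrunc_add_le {m : ℕ} {b b' : ℕ → Fin 2} (h : binaryTrunc m b' < binaryTrunc m b) :
    binaryTrunc m b' + ((2 : ℝ) ^ m)⁻¹ ≤ binaryTrunc m b := by
  obtain ⟨D, hD⟩ := binaryTrunc_mul_pow m b
  obtain ⟨D', hD'⟩ := binaryTrunc_mul_pow m b'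
  have h2 : (0 : ℝ) < 2 ^ m := by positivity
  have hlt : (D' : ℝ) < D := by rw [← hD, ← hD']; gcongr
  have hle : (D' : ℝ) + 1 ≤ D := by exact_mod_cast hlt
  rw [← mul_le_mul_iff_left₀ h2, add_mul, inv_mul_cancel₀ h2.ne', hD, hD']
  exact hle

theorem tendsto_binaryTrunc (b : ℕ → Fin 2) :
    Tendsto (fun m => binaryTrunc m b) atTop (𝓝 (Real.ofDigits b)) :=
  Real.summable_ofDigitsTerm.hasSum.tendsto_sum_nat

theorem continuous_binaryTrunc (m : ℕ) : Continuous (binaryTrunc m) := by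
  unfold binaryTrunc Real.ofDigitsTerm
  fun_prop

/-! ### Slopes, stages and the abscissa -/

/-- The slope used at stage `n`. -/
noncomputable def stageSlope (p : ℕ → ℕ) (n : ℕ) : ℝ := ((2 : ℝ) ^ (p n + 1))⁻¹

theorem stageSlope_pos (p : ℕ → ℕ) (n : ℕ) : 0 < stageSlope p n := by
  unfold stageSlope; positivity

theorem stageSlope_le_half (p : ℕ → ℕ) (n : ℕ) : stageSlope p n ≤ 1 / 2 := by
  unfold stageSlope
  rw [pow_succ, mul_inv]
  have : ((2 : ℝ) ^ p n)⁻¹ ≤ 1 := inv_le_one_of_one_le₀ (one_le_pow₀ (by norm_num))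
  linarith

theorem stageSlope_antitone {p : ℕ → ℕ} (hp : StrictMono p) : Antitone (stageSlope p) := by
  intro m n h
  unfold stageSlope
  have := hp.monotone h
  gcongr
  norm_num

/-- This halving guarantees that later stages cannot undo an advance of the abscissa made at stage
`n`. -/
theorem two_mul_stageSlope_succ_le {p : ℕ → ℕ} (hp : StrictMono p) (n : ℕ) :
    2 * stageSlope p (n + 1) ≤ stageSlope p n := by
  have h : p n + 1 ≤ p (n + 1) := hp n.lt_succ_self
  unfold stageSlope
  calc 2 * ((2 : ℝ) ^ (p (n + 1) + 1))⁻¹ = ((2 : ℝ) ^ p (n + 1))⁻¹ := by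
        rw [pow_succ]; field_simp
    _ ≤ _ := by gcongr; norm_num

/-- The increment of the truncated binary expansion at stage `n`. -/
noncomputable def stageIncr (q : ℕ → ℕ) (n : ℕ) (b : ℕ → Fin 2) : ℝ :=
  binaryTrunc (q (n + 1)) b - binaryTrunc (q n) b

section

variable {p q : ℕ → ℕ}

theorem stageIncr_nonneg (hq : StrictMono q) (n : ℕ) (b : ℕ → Fin 2) : 0 ≤ stageIncr q n b :=
  sub_nonneg.2 (binaryTrunc_mono b (hq n.lt_succ_self).le)

theorem hasSum_stageIncr (hq : StrictMono q) (n : ℕ) (b : ℕ → Fin 2) :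
    HasSum (fun k => stageIncr q (k + n) b) (Real.ofDigits b - binaryTrunc (q n) b) := by
  rw [hasSum_iff_tendsto_nat_of_nonneg fun k => stageIncr_nonneg hq _ b]
  have : ∀ N, ∑ k ∈ Finset.range N, stageIncr q (k + n) b =
      binaryTrunc (q (N + n)) b - binaryTrunc (q n) b := by
    intro N
    have := Finset.sum_range_sub (fun k => binaryTrunc (q (k + n)) b) N
    simp only [zero_add] at this
    rw [← this]
    refine Finset.sum_congr rfl fun k _ => ?_
    rw [stageIncr, add_right_comm]
  simp only [this]
  exact ((tendsto_binaryTrunc b).comp (hq.tendsto_atTop.comp (tendsto_add_atTop_nat n))).sub_const _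

/-- The contribution of the stages from `n` on to the abscissa. -/
noncomputable def stageTail (p q : ℕ → ℕ) (n : ℕ) (b : ℕ → Fin 2) : ℝ :=
  ∑' k, stageSlope p (k + n) * stageIncr q (k + n) b

theorem stageTerm_le (hp : StrictMono p) (hq : StrictMono q) (n k : ℕ) (b : ℕ → Fin 2) :
    stageSlope p (k + n) * stageIncr q (k + n) b ≤ stageSlope p n * stageIncr q (k + n) b :=
  mul_le_mul_of_nonneg_right (stageSlope_antitone hp (Nat.le_add_left _ _))
    (stageIncr_nonneg hq _ b)

theorem stageTerm_nonneg (hq : StrictMono q) (n : ℕ) (b : ℕ → Fin 2) :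
    0 ≤ stageSlope p n * stageIncr q n b :=
  mul_nonneg (stageSlope_pos p n).le (stageIncr_nonneg hq n b)

theorem summable_stageTerm (hp : StrictMono p) (hq : StrictMono q) (n : ℕ) (b : ℕ → Fin 2) :
    Summable fun k => stageSlope p (k + n) * stageIncr q (k + n) b :=
  Summable.of_nonneg_of_le (fun _ => stageTerm_nonneg hq _ b)
    (fun k => stageTerm_le hp hq n k b) ((hasSum_stageIncr hq n b).summable.mul_left _)

theorem stageTail_nonneg (hq : StrictMono q) (n : ℕ) (b : ℕ → Fin 2) :
    0 ≤ stageTail p q n b :=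
  tsum_nonneg fun _ => stageTerm_nonneg hq _ b

theorem stageTail_le (hp : StrictMono p) (hq : StrictMono q) (n : ℕ) (b : ℕ → Fin 2) :
    stageTail p q n b ≤ stageSlope p n * (Real.ofDigits b - binaryTrunc (q n) b) := by
  rw [← (hasSum_stageIncr hq n b).tsum_eq, ← tsum_mul_left]
  exact (summable_stageTerm hp hq n b).tsum_le_tsum (fun k => stageTerm_le hp hq n k b)
    ((hasSum_stageIncr hq n b).summable.mul_left _)

theorem stageTail_le_pow (hp : StrictMono p) (hq : StrictMono q) (n : ℕ) (b : ℕ → Fin 2) :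
    stageTail p q n b ≤ stageSlope p n * ((2 : ℝ) ^ q n)⁻¹ :=
  (stageTail_le hp hq n b).trans (mul_le_mul_of_nonneg_left (ofDigits_sub_binaryTrunc_le _ b)
    (stageSlope_pos p n).le)

theorem stageTail_eq (hp : StrictMono p) (hq : StrictMono q) (n : ℕ) (b : ℕ → Fin 2) :
    stageTail p q n b = stageSlope p n * stageIncr q n b + stageTail p q (n + 1) b := by
  rw [stageTail, (summable_stageTerm hp hq n b).tsum_eq_zero_add, zero_add, stageTail]
  congr 1
  refine tsum_congr fun k => ?_
  rw [add_right_comm, add_assoc]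

/-- The contribution of the stages before `n` to the abscissa. -/
noncomputable def stageHead (p q : ℕ → ℕ) (n : ℕ) (b : ℕ → Fin 2) : ℝ :=
  ∑ k ∈ Finset.range n, stageSlope p k * stageIncr q k b

theorem stageHead_congr {n : ℕ} {b b' : ℕ → Fin 2}
    (h : ∀ k ≤ n, binaryTrunc (q k) b = binaryTrunc (q k) b') :
    stageHead p q n b = stageHead p q n b' :=
  Finset.sum_congr rfl fun k hk => by
    have hk := Finset.mem_range.1 hk
    rw [stageIncr, stageIncr, h k hk.le, h (k + 1) hk]

/-- The abscissa of the point of the graph with digits `b`. -/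
noncomputable def abscissa (p q : ℕ → ℕ) (b : ℕ → Fin 2) : ℝ := -1 / 2 + stageTail p q 0 b

theorem abscissa_eq (hp : StrictMono p) (hq : StrictMono q) (n : ℕ) (b : ℕ → Fin 2) :
    abscissa p q b = -1 / 2 + stageHead p q n b + stageTail p q n b := by
  induction n with
  | zero => simp [abscissa, stageHead]
  | succ n ih =>
    rw [ih, stageTail_eq hp hq n, stageHead, stageHead, Finset.sum_range_succ]
    ring

/-- The sign matters: for `x ≤ 0` the term `-x²` increases with `x`, and every point of the graph is
at distance at least `2^(p n)` from the centre `2^(p n)`. -/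
theorem abscissa_mem_Icc (hp : StrictMono p) (hq : StrictMono q) (b : ℕ → Fin 2) :
    abscissa p q b ∈ Icc (-1 / 2 : ℝ) 0 := by
  have h1 := stageTail_nonneg (p := p) hq 0 b
  have h2 := stageTail_le_pow hp hq 0 b
  have h3 := stageSlope_le_half p 0
  have h4 : ((2 : ℝ) ^ q 0)⁻¹ ≤ 1 := inv_le_one_of_one_le₀ (one_le_pow₀ (by norm_num))
  have h5 := stageSlope_pos p 0
  unfold abscissa
  constructor
  · linarith
  · nlinarith

theorem continuous_abscissa (hq : StrictMono q) : Continuous (abscissa p q) := by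
  unfold abscissa stageTail
  refine continuous_const.add (continuous_tsum (u := fun k : ℕ => ((1 : ℝ) / 2) ^ k) ?_ ?_ ?_)
  · intro k
    unfold stageIncr
    have := continuous_binaryTrunc
    fun_prop
  · exact summable_geometric_of_lt_one (by norm_num) (by norm_num)
  · intro k b
    rw [Real.norm_of_nonneg (stageTerm_nonneg hq _ b), add_zero]
    have h1 := binaryTrunc_le (q (k + 1)) b
    have h2 := ofDigits_sub_binaryTrunc_le (q k) b
    have h3 := stageIncr_nonneg hq k b
    have h4 : ((2 : ℝ) ^ q k)⁻¹ ≤ ((2 : ℝ) ^ k)⁻¹ := by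
      have := hq.id_le k
      simp only [id] at this
      gcongr
      norm_num
    have h5 := stageSlope_le_half p k
    rw [one_div, inv_pow]
    have h6 : stageIncr q k b ≤ ((2 : ℝ) ^ k)⁻¹ := by unfold stageIncr; linarith
    nlinarith

theorem abs_abscissa_sub_le (hp : StrictMono p) (hq : StrictMono q) {n : ℕ} {b b' : ℕ → Fin 2}
    (h : ∀ i < q n, b i = b' i) :
    |abscissa p q b - abscissa p q b'| ≤ stageSlope p n * ((2 : ℝ) ^ q n)⁻¹ := by
  rw [abscissa_eq hp hq n, abscissa_eq hp hq n b',
    stageHead_congr fun k hk => binaryTrunc_congr h (hq.monotone hk), abs_le]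
  have h1 := stageTail_nonneg (p := p) hq n b
  have h2 := stageTail_le_pow hp hq n b
  have h3 := stageTail_nonneg (p := p) hq n b'
  have h4 := stageTail_le_pow hp hq n b'
  constructor <;> linarith

/-- Along a piece of stage `n`, the graph stays close to a line of slope `stageSlope p n` in the
coordinates `(ofDigits b, abscissa p q b)`. -/
theorem abs_abscissa_sub_mul_ofDigits_sub_le (hp : StrictMono p) (hq : StrictMono q) {n : ℕ}
    {b b' : ℕ → Fin 2} (h : ∀ i < q n, b i = b' i) :
    |(abscissa p q b - stageSlope p n * Real.ofDigits b) -
      (abscissa p q b' - stageSlope p n * Real.ofDigits b')| ≤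
      stageSlope p n * ((2 : ℝ) ^ q (n + 1))⁻¹ := by
  rw [abscissa_eq hp hq n, abscissa_eq hp hq n b', stageTail_eq hp hq, stageTail_eq hp hq n b',
    stageHead_congr fun k hk => binaryTrunc_congr h (hq.monotone hk), stageIncr, stageIncr,
    binaryTrunc_congr h le_rfl, abs_le]
  have hs := stageSlope_pos p n
  have hanti := stageSlope_antitone hp n.le_succ
  -- The stage `n` increments cancel exactly against `stageSlope p n * u`. Only places from `q
  -- (n+1)` on remain, and their slopes lie between 0 and `stageSlope p n`.
  have key : ∀ b, 0 ≤ stageSlope p n * (Real.ofDigits b - binaryTrunc (q (n + 1)) b) -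
      stageTail p q (n + 1) b ∧
      stageSlope p n * (Real.ofDigits b - binaryTrunc (q (n + 1)) b) -
      stageTail p q (n + 1) b ≤ stageSlope p n * ((2 : ℝ) ^ q (n + 1))⁻¹ := by
    intro b
    have h1 := stageTail_nonneg (p := p) hq (n + 1) b
    have h2 := stageTail_le hp hq (n + 1) b
    have h3 := binaryTrunc_le (q (n + 1)) b
    have h4 := mul_le_mul_of_nonneg_left (ofDigits_sub_binaryTrunc_le (q (n + 1)) b) hs.le
    have h5 := mul_le_mul_of_nonneg_right hanti (sub_nonneg.2 h3)
    simp only [Nat.succ_eq_add_one] at h5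
    constructor <;> linarith
  have k1 := key b
  have k2 := key b'
  constructor <;> linarith [k1.1, k1.2, k2.1, k2.2]

/-- Two digit sequences whose truncations first differ at stage `n + 1`. -/
theorem abscissa_lt_and_ofDigits_le (hp : StrictMono p) (hq : StrictMono q) {n : ℕ}
    {b b' : ℕ → Fin 2} (h : ∀ k ≤ n, binaryTrunc (q k) b = binaryTrunc (q k) b')
    (hlt : binaryTrunc (q (n + 1)) b' < binaryTrunc (q (n + 1)) b) :
    abscissa p q b' < abscissa p q b ∧ Real.ofDigits b' ≤ Real.ofDigits b ∧
      stageSlope p n * (Real.ofDigits b - Real.ofDigits b') ≤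
        4 * (abscissa p q b - abscissa p q b') ∧
      Real.ofDigits b - Real.ofDigits b' ≤ ((2 : ℝ) ^ q n)⁻¹ := by
  have hD := binaryTrunc_add_le hlt
  have hs := stageSlope_pos p n
  have hs2 := two_mul_stageSlope_succ_le hp n
  have h0 : (0 : ℝ) < ((2 : ℝ) ^ q (n + 1))⁻¹ := by positivity
  -- The truncations differ by at least `2^-q(n+1)`, and the tail of `b'` can cancel at most half of
  -- the resulting gain.
  have hx : stageSlope p n * (binaryTrunc (q (n + 1)) b - binaryTrunc (q (n + 1)) b') ≤
      2 * (abscissa p q b - abscissa p q b') := by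
    rw [abscissa_eq hp hq n, abscissa_eq hp hq n b', stageTail_eq hp hq, stageTail_eq hp hq n b',
      stageHead_congr h, stageIncr, stageIncr, h n le_rfl]
    have h1 := stageTail_nonneg (p := p) hq (n + 1) b
    have h2 := stageTail_le_pow hp hq (n + 1) b'
    have h3 := mul_le_mul_of_nonneg_right hs2 h0.le
    have h4 := mul_le_mul_of_nonneg_left hD hs.le
    linarith
  have e1 := binaryTrunc_le (q (n + 1)) b
  have e2 := ofDigits_sub_binaryTrunc_le (q (n + 1)) b
  have e3 := binaryTrunc_le (q (n + 1)) b'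
  have e4 := ofDigits_sub_binaryTrunc_le (q (n + 1)) b'
  have f1 := ofDigits_sub_binaryTrunc_le (q n) b
  have f2 := binaryTrunc_le (q n) b'
  have f3 := h n le_rfl
  refine ⟨?_, by linarith, ?_, by linarith⟩
  · have := mul_pos hs (h0.trans_le (show _ ≤ binaryTrunc (q (n + 1)) b -
      binaryTrunc (q (n + 1)) b' by linarith))
    linarith
  -- Restoring the remaining digits at most doubles the gap between truncations. With the factor 2
  -- of `hx` this gives the constant 4.
  · have := mul_le_mul_of_nonneg_left (show Real.ofDigits b - Real.ofDigits b' ≤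
      2 * (binaryTrunc (q (n + 1)) b - binaryTrunc (q (n + 1)) b') by linarith) hs.le
    linarith

/-- Two digit sequences either have the same truncations at every stage, or there is a first stage
where they differ. -/
theorem binaryTrunc_trichotomy (hq0 : q 0 = 0) (b b' : ℕ → Fin 2) :
    (∀ k, binaryTrunc (q k) b = binaryTrunc (q k) b') ∨
      ∃ n, (∀ k ≤ n, binaryTrunc (q k) b = binaryTrunc (q k) b') ∧
        (binaryTrunc (q (n + 1)) b' < binaryTrunc (q (n + 1)) b ∨
          binaryTrunc (q (n + 1)) b < binaryTrunc (q (n + 1)) b') := by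
  classical
  by_cases hall : ∀ k, binaryTrunc (q k) b = binaryTrunc (q k) b'
  · exact Or.inl hall
  · push Not at hall
    right
    have hspec := Nat.find_spec hall
    have hmin := fun m => Nat.find_min hall (m := m)
    obtain h0 | ⟨n, hn⟩ := Nat.eq_zero_or_eq_succ_pred (Nat.find hall) |>.imp id
      fun h => (⟨_, h⟩ : ∃ n, Nat.find hall = n + 1)
    · rw [h0, hq0] at hspec
      simp [binaryTrunc] at hspec
    · rw [hn] at hspec
      refine ⟨n, fun k hk => ?_, (lt_or_gt_of_ne hspec).symm⟩
      exact not_not.1 (hmin k (by omega))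

theorem ofDigits_congr (hq : StrictMono q) {b b' : ℕ → Fin 2}
    (h : ∀ k, binaryTrunc (q k) b = binaryTrunc (q k) b') :
    Real.ofDigits b = Real.ofDigits b' := by
  refine tendsto_nhds_unique ((tendsto_binaryTrunc b).comp hq.tendsto_atTop) ?_
  refine ((tendsto_binaryTrunc b').comp hq.tendsto_atTop).congr fun k => (h k).symm

theorem ofDigits_le_of_abscissa_le (hp : StrictMono p) (hq0 : q 0 = 0) (hq : StrictMono q)
    {b b' : ℕ → Fin 2} (h : abscissa p q b' ≤ abscissa p q b) :
    Real.ofDigits b' ≤ Real.ofDigits b := by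
  obtain hall | ⟨n, hn, hlt | hlt⟩ := binaryTrunc_trichotomy hq0 b b'
  · exact (ofDigits_congr hq hall).ge
  · exact (abscissa_lt_and_ofDigits_le hp hq hn hlt).2.1
  · exact absurd (abscissa_lt_and_ofDigits_le hp hq (fun k hk => (hn k hk).symm) hlt).1
      (not_lt.2 h)

end

/-! ### The Cantor domain, the graph and their sizes -/

/-- A Lebesgue null subset of the line is totally disconnected. -/
theorem isTotallyDisconnected_of_volume_eq_zero {C : Set ℝ} (hC : volume C = 0) :
    IsTotallyDisconnected C := by
  intro t htC ht x hx y hy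
  by_contra hne
  wlog hlt : x < y generalizing x y
  · exact this hy hx (Ne.symm hne) (lt_of_le_of_ne (not_lt.1 hlt) (Ne.symm hne))
  have h1 := measure_mono_null ((ht.Icc_subset hx hy).trans htC) hC
  rw [Real.volume_Icc, ENNReal.ofReal_eq_zero] at h1
  linarith

theorem tendsto_two_rpow_nhds_zero {e : ℕ → ℝ} (he : Tendsto e atTop atBot) :
    Tendsto (fun n => (2 : ℝ) ^ e n) atTop (𝓝 0) :=
  (tendsto_rpow_atBot_of_base_gt_one 2 (by norm_num)).comp he

/-- The domain of the graph. -/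
noncomputable def cantorDomain (p q : ℕ → ℕ) : Set ℝ := range (abscissa p q)

/-- The squared modulus of the points of the graph, minus one, as a function of the abscissa. -/
noncomputable def cantorFun (p q : ℕ → ℕ) (x : ℝ) : ℝ :=
  Real.ofDigits (Function.invFun (abscissa p q) x)

/-- The function whose graph is used. -/
noncomputable def graphFun (p q : ℕ → ℕ) (x : ℝ) : ℝ := √(1 + cantorFun p q x - x ^ 2)

/-- The point of the graph with digits `b`. -/
noncomputable def graphPoint (p q : ℕ → ℕ) (b : ℕ → Fin 2) : ℂ :=
  ⟨abscissa p q b, √(1 + Real.ofDigits b - abscissa p q b ^ 2)⟩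

section

variable {p q : ℕ → ℕ}

/-- The preimage picked by `Function.invFun` is irrelevant: sequences with equal abscissas represent
the same number, by monotonicity in both directions. -/
theorem cantorFun_abscissa (hp : StrictMono p) (hq0 : q 0 = 0) (hq : StrictMono q)
    (b : ℕ → Fin 2) : cantorFun p q (abscissa p q b) = Real.ofDigits b := by
  have h : abscissa p q (Function.invFun (abscissa p q) (abscissa p q b)) = abscissa p q b :=
    Function.invFun_eq ⟨b, rfl⟩
  exact le_antisymm (ofDigits_le_of_abscissa_le hp hq0 hq h.le)
    (ofDigits_le_of_abscissa_le hp hq0 hq h.ge)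

theorem planeGraphOn_eq_range (hp : StrictMono p) (hq0 : q 0 = 0) (hq : StrictMono q) :
    planeGraphOn (cantorDomain p q) (graphFun p q) = range (graphPoint p q) := by
  ext z
  constructor
  · rintro ⟨⟨b, hb⟩, him⟩
    refine ⟨b, Complex.ext hb ?_⟩
    rw [him, ← hb, graphFun, cantorFun_abscissa hp hq0 hq]
    rfl
  · rintro ⟨b, rfl⟩
    refine ⟨⟨b, rfl⟩, ?_⟩
    show _ = graphFun p q (abscissa p q b)
    rw [graphFun, cantorFun_abscissa hp hq0 hq]
    rfl

theorem continuous_graphPoint (hq : StrictMono q) : Continuous (graphPoint p q) := by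
  have h1 := continuous_abscissa (p := p) hq
  have h2 : Continuous (@Real.ofDigits 2) := Real.continuous_ofDigits
  have : graphPoint p q = fun b => ((abscissa p q b : ℝ) : ℂ) +
      ((√(1 + Real.ofDigits b - abscissa p q b ^ 2) : ℝ) : ℂ) * Complex.I := by
    ext b
    exact Complex.mk_eq_add_mul_I _ _
  rw [this]
  fun_prop

theorem sq_norm_graphPoint (hp : StrictMono p) (hq : StrictMono q) (b : ℕ → Fin 2) :
    ‖graphPoint p q b‖ ^ 2 = 1 + Real.ofDigits b := by
  have h1 := abscissa_mem_Icc hp hq b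
  have h2 := Real.ofDigits_nonneg b
  rw [Complex.sq_norm, Complex.normSq_apply]
  simp only [graphPoint]
  rw [Real.mul_self_sqrt (by nlinarith [h1.1, h1.2])]
  ring

theorem monotoneOn_graphFun (hp : StrictMono p) (hq0 : q 0 = 0) (hq : StrictMono q) :
    MonotoneOn (graphFun p q) (cantorDomain p q) := by
  rintro _ ⟨b, rfl⟩ _ ⟨b', rfl⟩ h
  rw [graphFun, graphFun, cantorFun_abscissa hp hq0 hq, cantorFun_abscissa hp hq0 hq]
  apply Real.sqrt_le_sqrt
  have h1 := ofDigits_le_of_abscissa_le hp hq0 hq h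
  have h2 := (abscissa_mem_Icc hp hq b).2
  have h3 := (abscissa_mem_Icc hp hq b').2
  nlinarith

/-- The modulus is 1-Lipschitz and its values on the graph cover `[1, √2]`, because `|z|² - 1` takes
every value in `[0,1]`. -/
theorem hausdorffMeasure_range_graphPoint_pos (hp : StrictMono p) (hq : StrictMono q) :
    0 < μH[1] (range (graphPoint p q)) := by
  have hle := (lipschitzWith_one_norm (E := ℂ)).hausdorffMeasure_image_le (d := 1) zero_le_one
    (range (graphPoint p q))
  rw [hausdorffMeasure_real] at hle
  simp only [ENNReal.coe_one, ENNReal.one_rpow, one_mul] at hle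
  refine lt_of_lt_of_le ?_ hle
  have hsub : Icc (1 : ℝ) (√2) ⊆ norm '' range (graphPoint p q) := by
    intro y hy
    have hy2 : y ^ 2 ≤ 2 := by
      have := pow_le_pow_left₀ (by linarith [hy.1]) hy.2 2
      rwa [Real.sq_sqrt (by norm_num)] at this
    obtain ⟨b, -, hb⟩ := Real.ofDigits_SurjOn (b := 2) (by norm_num)
      (show y ^ 2 - 1 ∈ Icc (0 : ℝ) 1 from ⟨by nlinarith [hy.1], by linarith⟩)
    refine ⟨_, ⟨b, rfl⟩, ?_⟩
    have := sq_norm_graphPoint hp hq b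
    rw [hb] at this
    rw [← abs_of_nonneg (norm_nonneg (graphPoint p q b)), ← abs_of_nonneg
      (show 0 ≤ y by linarith [hy.1]), ← sq_eq_sq_iff_abs_eq_abs]
    linarith
  refine lt_of_lt_of_le ?_ (measure_mono hsub)
  rw [Real.volume_Icc, ENNReal.ofReal_pos, sub_pos]
  exact Real.lt_sqrt_of_sq_lt (by norm_num)

theorem stageSlope_mul_inv_eq (n m : ℕ) :
    stageSlope p n * ((2 : ℝ) ^ m)⁻¹ = (2 : ℝ) ^ (-((p n : ℝ) + m + 1)) := by
  rw [stageSlope, ← mul_inv, ← pow_add, Real.rpow_neg (by norm_num)]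
  norm_cast
  ring_nf

theorem hausdorffMeasure_cantorDomain_eq_zero (hp : StrictMono p) (hq : StrictMono q) {d : ℝ}
    (hd : 0 ≤ d)
    (h : Tendsto (fun n => (q n : ℝ) - d * (p n + q n + 1)) atTop atBot) :
    μH[d] (cantorDomain p q) = 0 := by
  refine hausdorffMeasure_range_eq_zero_of_classes (abscissa p q) hd (fun n => Fin (q n) → Fin 2)
    (fun n b i => b i) (fun n => stageSlope p n * ((2 : ℝ) ^ q n)⁻¹)
    (fun n => mul_nonneg (stageSlope_pos p n).le (by positivity)) ?_ ?_ ?_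
  · simp only [stageSlope_mul_inv_eq]
    refine tendsto_two_rpow_nhds_zero (tendsto_neg_atTop_atBot.comp ?_)
    refine tendsto_atTop_mono (fun n => ?_) (tendsto_natCast_atTop_atTop.comp hq.tendsto_atTop)
    have : (0 : ℝ) ≤ p n := by positivity
    simp only [Function.comp_apply]
    linarith
  · intro n a b hab
    rw [Real.dist_eq]
    exact abs_abscissa_sub_le hp hq fun i hi => congrFun hab ⟨i, hi⟩
  · refine (tendsto_two_rpow_nhds_zero h).congr fun n => ?_
    rw [stageSlope_mul_inv_eq, ← Real.rpow_mul (by norm_num), Fintype.card_fun, Fintype.card_fin,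
      Fintype.card_fin]
    push_cast
    rw [← Real.rpow_natCast, ← Real.rpow_add (by norm_num)]
    ring_nf

theorem volume_cantorDomain (hp : StrictMono p) (hq : StrictMono q) :
    volume (cantorDomain p q) = 0 := by
  rw [← hausdorffMeasure_real]
  refine hausdorffMeasure_cantorDomain_eq_zero hp hq zero_le_one ?_
  have : Tendsto (fun n => -(p n : ℝ)) atTop atBot :=
    tendsto_neg_atTop_atBot.comp (tendsto_natCast_atTop_atTop.comp hp.tendsto_atTop)
  exact tendsto_atBot_mono (fun n => by linarith) this

theorem isCantorSet_cantorDomain (hp : StrictMono p) (hq0 : q 0 = 0) (hq : StrictMono q) :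
    IsCantorSet (cantorDomain p q) := by
  have hcomp : IsCompact (cantorDomain p q) := isCompact_range (continuous_abscissa hq)
  refine ⟨range_nonempty _, hcomp, ⟨hcomp.isClosed, ?_⟩,
    isTotallyDisconnected_of_volume_eq_zero (volume_cantorDomain hp hq)⟩
  rintro _ ⟨b, rfl⟩
  rw [accPt_iff_nhds]
  intro U hU
  obtain ⟨ε, hε, hball⟩ := Metric.mem_nhds_iff.1 hU
  obtain ⟨n, hn⟩ := exists_pow_lt_of_lt_one hε (show (1 / 2 : ℝ) < 1 by norm_num)
  -- Flipping the digit at place `q n` keeps all earlier digits, so the abscissa moves little. It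
  -- moves nonetheless, since the truncation at `q (n + 1)` changes.
  set b' := Function.update b (q n) (1 - b (q n)) with hb'
  have hagree : ∀ i < q n, b i = b' i := fun i hi => by
    rw [hb', Function.update_of_ne hi.ne]
  have hne : b (q n) ≠ b' (q n) := by
    rw [hb', Function.update_self]
    generalize b (q n) = c
    revert c
    decide
  refine ⟨abscissa p q b', ⟨hball ?_, ⟨b', rfl⟩⟩, fun heq => ?_⟩
  · rw [Metric.mem_ball, dist_comm, Real.dist_eq]
    refine (abs_abscissa_sub_le hp hq hagree).trans_lt (lt_of_le_of_lt ?_ hn)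
    have h1 : ((2 : ℝ) ^ q n)⁻¹ ≤ ((2 : ℝ) ^ n)⁻¹ := by
      have := hq.id_le n
      simp only [id] at this
      gcongr
      norm_num
    have h2 := stageSlope_le_half p n
    have h3 : (0 : ℝ) < ((2 : ℝ) ^ q n)⁻¹ := by positivity
    rw [one_div, inv_pow]
    nlinarith
  · have hall : binaryTrunc (q (n + 1)) b = binaryTrunc (q (n + 1)) b' := by
      obtain hall | ⟨m, hm, hlt | hlt⟩ := binaryTrunc_trichotomy hq0 b b'
      · exact hall _
      · exact absurd (abscissa_lt_and_ofDigits_le hp hq hm hlt).1 heq.not_lt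
      · exact absurd (abscissa_lt_and_ofDigits_le hp hq (fun k hk => (hm k hk).symm) hlt).1
          heq.not_gt
    rw [binaryTrunc, binaryTrunc, ← sub_eq_zero, ← Finset.sum_sub_distrib,
      Finset.sum_eq_single (q n)] at hall
    · simp only [Real.ofDigitsTerm, ← sub_mul, mul_eq_zero, sub_eq_zero] at hall
      obtain h | h := hall
      · exact hne (Fin.ext (by exact_mod_cast h))
      · exact absurd h (by positivity)
    · intro i _ hi
      simp [Real.ofDigitsTerm, hb', Function.update_of_ne hi]
    · intro h
      exact absurd (Finset.mem_range.2 (hq n.lt_succ_self)) h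

/-- If `n + 1` is the first stage where the truncations differ, the gap `u` satisfies both `u ≤
2^(-q n)` and `u ≤ 2^(p n + 3) |Δx|`. Interpolating them as `u = u^(1-d) u^d` leaves the exponent
bounded by `M`, plus `3 d ≤ 3`. -/
theorem abs_ofDigits_sub_le_rpow (hp : StrictMono p) (hq0 : q 0 = 0) (hq : StrictMono q) {d M : ℝ}
    (hd0 : 0 ≤ d) (hd1 : d ≤ 1) (hM : ∀ n, d * (p n + q n) - q n ≤ M) (b b' : ℕ → Fin 2) :
    |Real.ofDigits b - Real.ofDigits b'| ≤
      (2 : ℝ) ^ (M + 3) * |abscissa p q b - abscissa p q b'| ^ d := by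
  have key : ∀ (b b' : ℕ → Fin 2) (n : ℕ),
      (∀ k ≤ n, binaryTrunc (q k) b = binaryTrunc (q k) b') →
      binaryTrunc (q (n + 1)) b' < binaryTrunc (q (n + 1)) b →
      |Real.ofDigits b - Real.ofDigits b'| ≤
        (2 : ℝ) ^ (M + 3) * |abscissa p q b - abscissa p q b'| ^ d := by
    intro b b' n hn hlt
    obtain ⟨h1, h2, h3, h4⟩ := abscissa_lt_and_ofDigits_le hp hq hn hlt
    rw [abs_of_nonneg (sub_nonneg.2 h2), abs_of_pos (sub_pos.2 h1)]
    set u := Real.ofDigits b - Real.ofDigits b'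
    set x := abscissa p q b - abscissa p q b'
    have hu : 0 ≤ u := sub_nonneg.2 h2
    have hx : 0 ≤ x := (sub_pos.2 h1).le
    have h5 : u ≤ (2 : ℝ) ^ ((p n : ℝ) + 3) * x := by
      have hs : stageSlope p n * (2 : ℝ) ^ ((p n : ℝ) + 3) = 4 := by
        rw [stageSlope, show ((p n : ℝ) + 3) = ((p n + 3 : ℕ) : ℝ) by push_cast; ring,
          Real.rpow_natCast, pow_add, pow_add]
        field_simp
        norm_num
      have := stageSlope_pos p n
      rw [← mul_le_mul_iff_right₀ this, ← mul_assoc, hs]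
      exact h3
    have h4' : u ≤ (2 : ℝ) ^ (-(q n : ℝ)) := by
      rwa [Real.rpow_neg (by norm_num), Real.rpow_natCast]
    calc u = u ^ (1 - d) * u ^ d := by
          rw [← Real.rpow_add_of_nonneg hu (by linarith) hd0, sub_add_cancel, Real.rpow_one]
      _ ≤ ((2 : ℝ) ^ (-(q n : ℝ))) ^ (1 - d) * ((2 : ℝ) ^ ((p n : ℝ) + 3) * x) ^ d := by
          gcongr
      _ = (2 : ℝ) ^ (d * (p n + q n) - q n + 3 * d) * x ^ d := by
          rw [Real.mul_rpow (by positivity) hx, ← mul_assoc, ← Real.rpow_mul (by norm_num),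
            ← Real.rpow_mul (by norm_num), ← Real.rpow_add (by norm_num)]
          ring_nf
      _ ≤ _ := by
          gcongr
          · norm_num
          · exact hM n
          · linarith
  obtain hall | ⟨n, hn, hlt | hlt⟩ := binaryTrunc_trichotomy hq0 b b'
  · rw [ofDigits_congr hq hall, sub_self, abs_zero]
    positivity
  · exact key b b' n hn hlt
  · rw [abs_sub_comm, abs_sub_comm (abscissa p q b)]
    exact key b' b n (fun k hk => (hn k hk).symm) hlt

/-- The `d`-Hölder function `cantorFun` maps the domain onto `[0,1]`, which has dimension 1. -/
theorem le_dimH_cantorDomain (hp : StrictMono p) (hq0 : q 0 = 0) (hq : StrictMono q) {d : NNReal}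
    {M : ℝ} (hd0 : 0 < d) (hd1 : d ≤ 1) (hM : ∀ n, (d : ℝ) * (p n + q n) - q n ≤ M) :
    (d : ENNReal) ≤ dimH (cantorDomain p q) := by
  have hH : HolderOnWith ((2 : NNReal) ^ (M + 3)) d (cantorFun p q) (cantorDomain p q) := by
    rintro _ ⟨b, rfl⟩ _ ⟨b', rfl⟩
    rw [cantorFun_abscissa hp hq0 hq, cantorFun_abscissa hp hq0 hq, edist_dist, edist_dist,
      ENNReal.ofReal_rpow_of_nonneg dist_nonneg d.coe_nonneg]
    rw [← ENNReal.ofReal_coe_nnreal, ← ENNReal.ofReal_mul (NNReal.coe_nonneg _)]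
    apply ENNReal.ofReal_le_ofReal
    rw [Real.dist_eq, Real.dist_eq, NNReal.coe_rpow]
    exact abs_ofDigits_sub_le_rpow hp hq0 hq d.coe_nonneg (by exact_mod_cast hd1) hM b b'
  have himg : cantorFun p q '' cantorDomain p q = Icc 0 1 := by
    ext y
    constructor
    · rintro ⟨_, ⟨b, rfl⟩, rfl⟩
      rw [cantorFun_abscissa hp hq0 hq]
      exact ⟨Real.ofDigits_nonneg b, Real.ofDigits_le_one b⟩
    · intro hy
      obtain ⟨b, -, hb⟩ := Real.ofDigits_SurjOn (b := 2) (by norm_num) hy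
      exact ⟨_, ⟨b, rfl⟩, (cantorFun_abscissa hp hq0 hq b).trans hb⟩
  have h1 := hH.dimH_image_le hd0
  rw [himg, Real.dimH_of_nonempty_interior (by rw [interior_Icc]; exact ⟨1 / 2, by norm_num⟩),
    Module.finrank_self, Nat.cast_one,
    ENNReal.le_div_iff_mul_le (Or.inl (by simpa using hd0.ne')) (Or.inl ENNReal.coe_ne_top),
    one_mul] at h1
  exact h1

theorem dimH_cantorDomain (hp : StrictMono p) (hq0 : q 0 = 0) (hq : StrictMono q) {s : ℝ}
    (hs1 : s ≤ 1)
    (hup : ∀ d : ℝ, s < d → Tendsto (fun n => (q n : ℝ) - d * (p n + q n + 1)) atTop atBot)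
    (hlow : ∀ d : ℝ, 0 < d → d < s → ∃ M : ℝ, ∀ n, d * (p n + q n) - q n ≤ M) :
    dimH (cantorDomain p q) = ENNReal.ofReal s := by
  refine le_antisymm (dimH_le fun d hd => ?_) (ENNReal.le_of_forall_nnreal_lt fun d hd => ?_)
  · by_contra hlt
    rw [not_le, ← ENNReal.ofReal_coe_nnreal, ENNReal.ofReal_lt_ofReal_iff'] at hlt
    rw [hausdorffMeasure_cantorDomain_eq_zero hp hq d.coe_nonneg (hup d hlt.1)] at hd
    exact ENNReal.zero_ne_top hd
  · obtain rfl | hd0 := eq_zero_or_pos d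
    · simp
    · have hds : (d : ℝ) < s := by
        rwa [← ENNReal.ofReal_coe_nnreal, ENNReal.ofReal_lt_ofReal_iff_of_nonneg d.coe_nonneg]
          at hd
      obtain ⟨M, hM⟩ := hlow d (by exact_mod_cast hd0) hds
      exact le_dimH_cantorDomain hp hq0 hq hd0 (by exact_mod_cast (hds.le.trans hs1)) hM

end

/-! ### Rotations, polar coordinates and rounded angles -/

theorem norm_exp_mul_I_sub_le (s t : ℝ) :
    ‖Complex.exp (s * Complex.I) - Complex.exp (t * Complex.I)‖ ≤ |s - t| := by
  have h : Complex.exp (s * Complex.I) - Complex.exp (t * Complex.I) =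
      Complex.exp (t * Complex.I) * (Complex.exp (Complex.I * ((s - t : ℝ) : ℂ)) - 1) := by
    rw [mul_sub, ← Complex.exp_add, mul_one]
    congr 2
    push_cast
    ring
  rw [h, norm_mul, Complex.norm_exp_ofReal_mul_I, one_mul]
  exact Real.norm_exp_I_mul_ofReal_sub_one_le

theorem dist_le_abs_norm_sub_add_arg (w z : ℂ) :
    dist w z ≤ |‖w‖ - ‖z‖| + ‖z‖ * |w.arg - z.arg| := by
  have h : w - z = ((‖w‖ - ‖z‖ : ℝ) : ℂ) * Complex.exp (w.arg * Complex.I) +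
      (‖z‖ : ℂ) * (Complex.exp (w.arg * Complex.I) - Complex.exp (z.arg * Complex.I)) := by
    conv_lhs => rw [← Complex.norm_mul_exp_arg_mul_I w, ← Complex.norm_mul_exp_arg_mul_I z]
    push_cast
    ring
  rw [Complex.dist_eq, h]
  refine (norm_add_le _ _).trans (add_le_add ?_ ?_)
  · rw [norm_mul, Complex.norm_exp_ofReal_mul_I, mul_one, Complex.norm_real, Real.norm_eq_abs]
  · rw [norm_mul, Complex.norm_real, norm_norm]
    exact mul_le_mul_of_nonneg_left (norm_exp_mul_I_sub_le _ _) (norm_nonneg _)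

theorem abs_sub_le_of_natFloor_eq {x y : ℝ} (hx : 0 ≤ x) (hy : 0 ≤ y) (h : ⌊x⌋₊ = ⌊y⌋₊) :
    |x - y| ≤ 1 := by
  have h1 := Nat.floor_le hx
  have h2 := Nat.lt_floor_add_one x
  have h3 := Nat.floor_le hy
  have h4 := Nat.lt_floor_add_one y
  rw [h] at h1 h2
  rw [abs_le]
  constructor <;> linarith

/-- Rounding down to `m` binary places. -/
noncomputable def dyadicFloor (m : ℕ) (t : ℝ) : ℝ := (⌊2 ^ m * t⌋₊ : ℝ) / 2 ^ m

theorem abs_dyadicFloor_sub_le (m : ℕ) {t : ℝ} (ht : 0 ≤ t) :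
    |dyadicFloor m t - t| ≤ ((2 : ℝ) ^ m)⁻¹ := by
  have h2 : (0 : ℝ) < 2 ^ m := by positivity
  have h3 := Nat.floor_le (show (0 : ℝ) ≤ 2 ^ m * t by positivity)
  have h4 := Nat.lt_floor_add_one ((2 : ℝ) ^ m * t)
  have h5 : dyadicFloor m t - t = ((⌊2 ^ m * t⌋₊ : ℝ) - 2 ^ m * t) * ((2 : ℝ) ^ m)⁻¹ := by
    rw [dyadicFloor]; field_simp
  rw [h5, abs_mul, abs_of_pos (inv_pos.2 h2)]
  refine mul_le_of_le_one_left (inv_pos.2 h2).le ?_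
  rw [abs_le]
  constructor <;> linarith

/-- Dyadic intervals are nested, so agreement at the fine scale forces agreement at all coarser
ones. -/
theorem dyadicFloor_congr {m k : ℕ} (hk : k ≤ m) {s t : ℝ}
    (h : ⌊(2 : ℝ) ^ m * s⌋₊ = ⌊(2 : ℝ) ^ m * t⌋₊) : dyadicFloor k s = dyadicFloor k t := by
  have key : ∀ x : ℝ, ⌊(2 : ℝ) ^ k * x⌋₊ = ⌊(2 : ℝ) ^ m * x⌋₊ / 2 ^ (m - k) := by
    intro x
    rw [← Nat.floor_div_natCast]
    congr 1
    obtain ⟨j, rfl⟩ := Nat.exists_eq_add_of_le hk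
    rw [Nat.add_sub_cancel_left]
    push_cast
    rw [pow_add]
    field_simp
  rw [dyadicFloor, dyadicFloor, key, key t, h]

/-! ### Rotation centres and the Besicovitch set -/

/-- The number of binary places to which angles are rounded at stage `k`. -/
def angleBits (p q : ℕ → ℕ) (k : ℕ) : ℕ := p k + q k + k

/-- The displacement between the rotation centres of consecutive stages. -/
noncomputable def centerStep (p : ℕ → ℕ) : ℕ → ℝ
  | 0 => 2 ^ p 0
  | k + 1 => 2 ^ p (k + 1) - 2 ^ p k

/-- The translation used for the copy of the graph rotated by `t`. -/
noncomputable def angleShift (p q : ℕ → ℕ) (t : ℝ) : ℂ :=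
  ∑' k, (Complex.exp (dyadicFloor (angleBits p q k) t * Complex.I) -
    Complex.exp (t * Complex.I)) * centerStep p k

section

variable {p q : ℕ → ℕ}

theorem angleBits_monotone (hp : StrictMono p) (hq : StrictMono q) : Monotone (angleBits p q) :=
  fun _ _ h => add_le_add (add_le_add (hp.monotone h) (hq.monotone h)) h

theorem sum_centerStep (n : ℕ) : ∑ k ∈ Finset.range (n + 1), centerStep p k = 2 ^ p n := by
  induction n with
  | zero => simp [centerStep]
  | succ n ih => rw [Finset.sum_range_succ, ih, centerStep]; ring

theorem abs_centerStep_le (hp : StrictMono p) (k : ℕ) : |centerStep p k| ≤ 2 ^ p k := by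
  cases k with
  | zero => rw [centerStep, abs_of_nonneg (by positivity)]
  | succ k =>
    have h : (2 : ℝ) ^ p k ≤ 2 ^ p (k + 1) :=
      pow_le_pow_right₀ (by norm_num) (hp k.lt_succ_self).le
    have h2 : (0 : ℝ) < 2 ^ p k := by positivity
    rw [centerStep, abs_of_nonneg (by linarith)]
    linarith

/-- The angle error `2^-(p k + q k + k)` outweighs the displacement `2^(p k)`; the surplus `2^-k`
makes the series summable. -/
theorem norm_angleShift_term_le (hp : StrictMono p) {t : ℝ} (ht : 0 ≤ t) (k : ℕ) :
    ‖(Complex.exp (dyadicFloor (angleBits p q k) t * Complex.I) -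
      Complex.exp (t * Complex.I)) * centerStep p k‖ ≤
        ((2 : ℝ) ^ q k)⁻¹ * ((2 : ℝ) ^ k)⁻¹ := by
  rw [norm_mul, Complex.norm_real, Real.norm_eq_abs]
  calc _ ≤ ((2 : ℝ) ^ angleBits p q k)⁻¹ * 2 ^ p k := by
        gcongr
        · exact (norm_exp_mul_I_sub_le _ _).trans (abs_dyadicFloor_sub_le _ ht)
        · exact abs_centerStep_le hp k
    _ = _ := by
        rw [angleBits, pow_add, pow_add]
        field_simp

/-- The displacements up to stage `n` telescope to `2^(p n)`. Hence the copy with angle `t` is, up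
to `2^-q(n+1)`, the graph rotated about `2^(p n)` and translated so that this centre goes to a point
depending only on rounded angles. -/
theorem norm_angleShift_sub_le (hp : StrictMono p) (hq : StrictMono q) {t : ℝ} (ht : 0 ≤ t) (n : ℕ) :
    ‖angleShift p q t - (∑ k ∈ Finset.range (n + 1),
      Complex.exp (dyadicFloor (angleBits p q k) t * Complex.I) * centerStep p k -
      Complex.exp (t * Complex.I) * ((2 ^ p n : ℝ) : ℂ))‖ ≤ ((2 : ℝ) ^ q (n + 1))⁻¹ := by
  have hbound : ∀ m k : ℕ, ((2 : ℝ) ^ q (k + m))⁻¹ * ((2 : ℝ) ^ (k + m))⁻¹ ≤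
      ((2 : ℝ) ^ q m)⁻¹ * (((1 : ℝ) / 2) ^ k * ((2 : ℝ) ^ m)⁻¹) := by
    intro m k
    have := hq.monotone (Nat.le_add_left m k)
    rw [one_div, inv_pow, ← mul_inv ((2 : ℝ) ^ k), ← pow_add]
    gcongr
    norm_num
  have hgeo : ∀ m, HasSum (fun k : ℕ => ((2 : ℝ) ^ q m)⁻¹ *
      (((1 : ℝ) / 2) ^ k * ((2 : ℝ) ^ m)⁻¹)) (((2 : ℝ) ^ q m)⁻¹ * (2 * ((2 : ℝ) ^ m)⁻¹)) :=
    fun m => (hasSum_geometric_two.mul_right _).mul_left _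
  have hsum : Summable fun k => (Complex.exp (dyadicFloor (angleBits p q k) t * Complex.I) -
      Complex.exp (t * Complex.I)) * centerStep p k :=
    Summable.of_norm_bounded (hgeo 0).summable fun k =>
      (norm_angleShift_term_le hp ht k).trans (hbound 0 k)
  rw [angleShift, ← hsum.sum_add_tsum_nat_add (n + 1)]
  simp only [sub_mul, Finset.sum_sub_distrib, ← Finset.mul_sum]
  rw [← Complex.ofReal_sum, sum_centerStep, add_sub_cancel_left]
  refine (tsum_of_norm_bounded (hgeo (n + 1)) fun k => ?_).trans ?_
  · rw [← sub_mul]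
    exact (norm_angleShift_term_le hp ht _).trans (hbound _ k)
  · have h : (2 : ℝ) * ((2 : ℝ) ^ (n + 1))⁻¹ ≤ 1 := by
      rw [pow_succ, mul_inv]
      have : ((2 : ℝ) ^ n)⁻¹ ≤ 1 := inv_le_one_of_one_le₀ (one_le_pow₀ (by norm_num))
      linarith
    exact mul_le_of_le_one_right (by positivity) h

theorem sq_norm_graphPoint_sub (hp : StrictMono p) (hq : StrictMono q) (n : ℕ) (b : ℕ → Fin 2) :
    ‖graphPoint p q b - ((2 ^ p n : ℝ) : ℂ)‖ ^ 2 = (2 ^ p n) ^ 2 + 1 -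
      2 * 2 ^ p n * (abscissa p q b - stageSlope p n * Real.ofDigits b) := by
  have h := sq_norm_graphPoint hp hq b
  have h2 : 2 * 2 ^ p n * stageSlope p n = 1 := by
    rw [stageSlope, pow_succ]; field_simp
  rw [Complex.sq_norm, Complex.normSq_apply] at h ⊢
  simp only [Complex.sub_re, Complex.sub_im, Complex.ofReal_re, Complex.ofReal_im]
  have hre : (graphPoint p q b).re = abscissa p q b := rfl
  rw [hre] at h ⊢
  linear_combination h - Real.ofDigits b * h2

theorem le_norm_graphPoint_sub (hp : StrictMono p) (hq : StrictMono q) (n : ℕ)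
    (b : ℕ → Fin 2) : 2 ^ p n ≤ ‖graphPoint p q b - ((2 ^ p n : ℝ) : ℂ)‖ := by
  refine le_trans ?_ (Complex.abs_re_le_norm _)
  have h := (abscissa_mem_Icc hp hq b).2
  rw [Complex.sub_re, Complex.ofReal_re, abs_sub_comm]
  refine le_trans ?_ (le_abs_self _)
  show _ ≤ 2 ^ p n - abscissa p q b
  linarith

theorem norm_graphPoint_sub_le (hp : StrictMono p) (hq : StrictMono q) (n : ℕ)
    (b : ℕ → Fin 2) : ‖graphPoint p q b - ((2 ^ p n : ℝ) : ℂ)‖ ≤ 3 * 2 ^ p n := by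
  have h := sq_norm_graphPoint hp hq b
  have h1 := Real.ofDigits_le_one b
  have h2 : ‖graphPoint p q b‖ ≤ 2 := by nlinarith
  have h3 : (1 : ℝ) ≤ 2 ^ p n := one_le_pow₀ (by norm_num)
  refine (norm_sub_le _ _).trans ?_
  rw [Complex.norm_real, Real.norm_of_nonneg (by positivity)]
  linarith

/-- A piece of stage `n` is almost an arc about `2^(p n)`: the squared distance depends only on `x -
stageSlope p n * u`, and the sum of two distances is at least 1, so passing to square roots loses
nothing. -/
theorem abs_norm_graphPoint_sub_sub_le (hp : StrictMono p) (hq : StrictMono q) {n : ℕ}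
    {b b' : ℕ → Fin 2} (h : ∀ i < q n, b i = b' i) :
    |‖graphPoint p q b - ((2 ^ p n : ℝ) : ℂ)‖ - ‖graphPoint p q b' - ((2 ^ p n : ℝ) : ℂ)‖| ≤
      ((2 : ℝ) ^ q (n + 1))⁻¹ := by
  have h1 := sq_norm_graphPoint_sub hp hq n b
  have h2 := sq_norm_graphPoint_sub hp hq n b'
  have h3 := le_norm_graphPoint_sub hp hq n b
  have h4 := norm_nonneg (graphPoint p q b' - ((2 ^ p n : ℝ) : ℂ))
  have h5 := abs_abscissa_sub_mul_ofDigits_sub_le hp hq h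
  have h6 : (1 : ℝ) ≤ 2 ^ p n := one_le_pow₀ (by norm_num)
  have h7 : 2 * 2 ^ p n * stageSlope p n = 1 := by
    rw [stageSlope, pow_succ]; field_simp
  set x := ‖graphPoint p q b - ((2 ^ p n : ℝ) : ℂ)‖
  set y := ‖graphPoint p q b' - ((2 ^ p n : ℝ) : ℂ)‖
  set u := (abscissa p q b - stageSlope p n * Real.ofDigits b) -
      (abscissa p q b' - stageSlope p n * Real.ofDigits b') with hu
  have h8 : |x - y| * (x + y) = 2 * 2 ^ p n * |u| := by
    rw [← abs_of_nonneg (show 0 ≤ x + y by linarith), ← abs_mul,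
      ← abs_of_nonneg (show (0 : ℝ) ≤ 2 * 2 ^ p n by positivity), ← abs_mul, ← abs_neg]
    congr 1
    rw [hu]
    linear_combination h2 - h1
  calc |x - y| ≤ |x - y| * (x + y) := le_mul_of_one_le_right (abs_nonneg _) (by linarith)
    _ = 2 * 2 ^ p n * |u| := h8
    _ ≤ 2 * 2 ^ p n * (stageSlope p n * ((2 : ℝ) ^ q (n + 1))⁻¹) := by gcongr
    _ = _ := by rw [← mul_assoc, h7, one_mul]

/-- The rotated and translated copies of the graph, parametrised by the angle and the digits. -/
noncomputable def besicovitchPoint (p q : ℕ → ℕ) (x : Ico (0 : ℝ) 7 × (ℕ → Fin 2)) : ℂ :=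
  Complex.exp ((x.1 : ℝ) * Complex.I) * graphPoint p q x.2 + angleShift p q x.1

/-- The position relative to the rotation centre of stage `n`. -/
noncomputable def relativePoint (p q : ℕ → ℕ) (n : ℕ) (x : Ico (0 : ℝ) 7 × (ℕ → Fin 2)) : ℂ :=
  Complex.exp ((x.1 : ℝ) * Complex.I) * (graphPoint p q x.2 - ((2 ^ p n : ℝ) : ℂ))

theorem norm_relativePoint (n : ℕ) (x : Ico (0 : ℝ) 7 × (ℕ → Fin 2)) :
    ‖relativePoint p q n x‖ = ‖graphPoint p q x.2 - ((2 ^ p n : ℝ) : ℂ)‖ := by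
  rw [relativePoint, norm_mul, Complex.norm_exp_ofReal_mul_I, one_mul]

/-- Equal rounded angles give the same approximate centre, equal digits almost the same radius, and
equal rounded arguments an angular difference of at most `2^-(p n + q(n+1))` at radius at most `3 *
2^(p n)`. In units of `2^-q(n+1)`, radius and argument cost 1 + 3, and the two shifts 1 each, within
the allowed 8. -/
theorem dist_besicovitchPoint_le (hp : StrictMono p) (hq : StrictMono q) {n : ℕ}
    {x y : Ico (0 : ℝ) 7 × (ℕ → Fin 2)}
    (hang : ⌊(2 : ℝ) ^ angleBits p q n * x.1⌋₊ = ⌊(2 : ℝ) ^ angleBits p q n * y.1⌋₊)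
    (hdig : ∀ i < q n, x.2 i = y.2 i)
    (harg : ⌊(2 : ℝ) ^ (p n + q (n + 1)) * ((relativePoint p q n x).arg + 4)⌋₊ =
      ⌊(2 : ℝ) ^ (p n + q (n + 1)) * ((relativePoint p q n y).arg + 4)⌋₊) :
    dist (besicovitchPoint p q x) (besicovitchPoint p q y) ≤ 8 * ((2 : ℝ) ^ q (n + 1))⁻¹ := by
  set δ := ((2 : ℝ) ^ q (n + 1))⁻¹ with hδ
  have hx := norm_angleShift_sub_le hp hq x.1.2.1 n
  have hy := norm_angleShift_sub_le hp hq y.1.2.1 n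
  have hcenter : ∑ k ∈ Finset.range (n + 1),
      Complex.exp (dyadicFloor (angleBits p q k) x.1 * Complex.I) * centerStep p k =
      ∑ k ∈ Finset.range (n + 1),
      Complex.exp (dyadicFloor (angleBits p q k) y.1 * Complex.I) * centerStep p k :=
    Finset.sum_congr rfl fun k hk => by
      rw [dyadicFloor_congr (angleBits_monotone hp hq (Finset.mem_range_succ_iff.1 hk)) hang]
  have harg' : |(relativePoint p q n x).arg - (relativePoint p q n y).arg| ≤
      ((2 : ℝ) ^ (p n + q (n + 1)))⁻¹ := by
    have hpi := Real.pi_lt_four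
    have h1 := abs_sub_le_of_natFloor_eq
      (mul_nonneg (by positivity) (by linarith [Complex.neg_pi_lt_arg (relativePoint p q n x)]))
      (mul_nonneg (by positivity) (by linarith [Complex.neg_pi_lt_arg (relativePoint p q n y)]))
      harg
    rw [← mul_sub, add_sub_add_right_eq_sub, abs_mul, abs_of_pos (by positivity)] at h1
    rwa [inv_eq_one_div, le_div_iff₀' (by positivity)]
  have hrel : dist (relativePoint p q n x) (relativePoint p q n y) ≤ 4 * δ := by
    refine (dist_le_abs_norm_sub_add_arg _ _).trans ?_
    have h1 := abs_norm_graphPoint_sub_sub_le (p := p) hp hq hdig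
    rw [norm_relativePoint, norm_relativePoint]
    have h2 := norm_graphPoint_sub_le hp hq n y.2
    calc _ ≤ δ + 3 * 2 ^ p n * ((2 : ℝ) ^ (p n + q (n + 1)))⁻¹ := by gcongr
      _ = 4 * δ := by
        rw [hδ, pow_add]
        field_simp
        norm_num
  rw [hcenter] at hx
  set w := ∑ k ∈ Finset.range (n + 1),
      Complex.exp (dyadicFloor (angleBits p q k) y.1 * Complex.I) * centerStep p k
  have hδ0 : 0 < δ := by rw [hδ]; positivity
  rw [Complex.dist_eq] at hrel ⊢
  have heq : besicovitchPoint p q x - besicovitchPoint p q y =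
      (relativePoint p q n x - relativePoint p q n y) +
      ((angleShift p q x.1 - (w - Complex.exp ((x.1 : ℝ) * Complex.I) * ((2 ^ p n : ℝ) : ℂ))) -
      (angleShift p q y.1 - (w - Complex.exp ((y.1 : ℝ) * Complex.I) * ((2 ^ p n : ℝ) : ℂ)))) := by
    simp only [besicovitchPoint, relativePoint]
    ring
  rw [heq]
  refine (norm_add_le _ _).trans ((add_le_add hrel (norm_sub_le _ _)).trans ?_)
  linarith

theorem hausdorffMeasure_range_besicovitchPoint (hp : StrictMono p) (hq : StrictMono q) {d : ℝ}
    (hd : 0 ≤ d)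
    (h : Tendsto (fun n => (6 + 2 * p n + 2 * q n + n + q (n + 1) : ℝ) + (3 - q (n + 1)) * d)
      atTop atBot) :
    μH[d] (range (besicovitchPoint p q)) = 0 := by
  have hr : ∀ n, 8 * ((2 : ℝ) ^ q (n + 1))⁻¹ = (2 : ℝ) ^ ((3 : ℝ) - q (n + 1)) := by
    intro n
    rw [Real.rpow_sub (by norm_num), Real.rpow_natCast, div_eq_mul_inv]
    norm_num
  have hang : ∀ n (x : Ico (0 : ℝ) 7 × (ℕ → Fin 2)),
      ⌊(2 : ℝ) ^ angleBits p q n * x.1⌋₊ < 8 * 2 ^ angleBits p q n := by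
    intro n x
    have hx := x.1.2
    rw [Nat.floor_lt (mul_nonneg (by positivity) hx.1)]
    push_cast
    rw [mul_comm]
    gcongr
    linarith [hx.2]
  have harg : ∀ n (x : Ico (0 : ℝ) 7 × (ℕ → Fin 2)),
      ⌊(2 : ℝ) ^ (p n + q (n + 1)) * ((relativePoint p q n x).arg + 4)⌋₊ <
        8 * 2 ^ (p n + q (n + 1)) := by
    intro n x
    have hpi := Real.pi_lt_four
    have h1 := Complex.neg_pi_lt_arg (relativePoint p q n x)
    have h2 := Complex.arg_le_pi (relativePoint p q n x)
    rw [Nat.floor_lt (mul_nonneg (by positivity) (by linarith))]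
    push_cast
    rw [mul_comm]
    gcongr
    linarith
  refine hausdorffMeasure_range_eq_zero_of_classes (besicovitchPoint p q) hd
    -- The classes record rounded angle, leading digits and rounded argument. The factors 8 come
    -- from angles in `[0, 7)` and from arguments shifted by 4 to lie in `[0, 8)`.
    (fun n => Fin (8 * 2 ^ angleBits p q n) × (Fin (q n) → Fin 2) ×
      Fin (8 * 2 ^ (p n + q (n + 1))))
    (fun n x => (⟨_, hang n x⟩, fun i => x.2 i, ⟨_, harg n x⟩))
    (fun n => 8 * ((2 : ℝ) ^ q (n + 1))⁻¹) (fun n => by positivity) ?_ ?_ ?_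
  · simp only [hr]
    refine tendsto_two_rpow_nhds_zero (tendsto_atBot_add_const_left _ _ ?_)
    exact tendsto_neg_atTop_atBot.comp (tendsto_natCast_atTop_atTop.comp
      (hq.tendsto_atTop.comp (tendsto_add_atTop_nat 1)))
  · intro n x y hxy
    simp only [Prod.mk.injEq, Fin.mk.injEq] at hxy
    exact dist_besicovitchPoint_le hp hq hxy.1 (fun i hi => congrFun hxy.2.1 ⟨i, hi⟩) hxy.2.2
  · refine (tendsto_two_rpow_nhds_zero h).congr fun n => ?_
    rw [hr, ← Real.rpow_mul (by norm_num), Real.rpow_add (by norm_num)]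
    congr 1
    rw [← Nat.card_eq_fintype_card]
    simp only [Nat.card_prod, Nat.card_fun, Nat.card_fin, angleBits]
    rw [show (6 + 2 * p n + 2 * q n + n + q (n + 1) : ℝ) =
      ((6 + 2 * p n + 2 * q n + n + q (n + 1) : ℕ) : ℝ) by push_cast; ring, Real.rpow_natCast]
    push_cast
    ring

theorem isBesicovitchSetFor_range (hp : StrictMono p) (hq0 : q 0 = 0) (hq : StrictMono q) :
    IsBesicovitchSetFor (planeGraphOn (cantorDomain p q) (graphFun p q))
      (range (besicovitchPoint p q)) := by
  intro θ
  rw [planeGraphOn_eq_range hp hq0 hq]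
  have hmem := toIcoMod_mem_Ico Real.two_pi_pos 0 θ
  have h7 : toIcoMod Real.two_pi_pos 0 θ ∈ Ico (0 : ℝ) 7 :=
    ⟨hmem.1, hmem.2.trans (by linarith [Real.pi_lt_d2])⟩
  have hexp : Complex.exp (θ * Complex.I) =
      Complex.exp ((toIcoMod Real.two_pi_pos 0 θ : ℝ) * Complex.I) := by
    rw [Complex.exp_eq_exp_iff_exists_int]
    refine ⟨toIcoDiv Real.two_pi_pos 0 θ, ?_⟩
    have := toIcoMod_add_toIcoDiv_zsmul Real.two_pi_pos 0 θ
    conv_lhs => rw [← this]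
    simp only [zsmul_eq_mul]
    push_cast
    ring
  refine ⟨angleShift p q (toIcoMod Real.two_pi_pos 0 θ), ?_⟩
  rintro _ ⟨_, ⟨b, rfl⟩, rfl⟩
  refine ⟨(⟨_, h7⟩, b), ?_⟩
  simp only [besicovitchPoint, hexp]

theorem dimH_range_besicovitchPoint (hp : StrictMono p) (hq0 : q 0 = 0) (hq : StrictMono q)
    (h : ∀ d : ℝ, 1 < d → Tendsto (fun n => (6 + 2 * p n + 2 * q n + n + q (n + 1) : ℝ) +
      (3 - q (n + 1)) * d) atTop atBot) :
    dimH (range (besicovitchPoint p q)) = 1 := by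
  refine le_antisymm (dimH_le fun d hd => ?_) ?_
  · by_contra hlt
    rw [not_le] at hlt
    have hlt' : (1 : ℝ) < d := by exact_mod_cast hlt
    rw [hausdorffMeasure_range_besicovitchPoint hp hq d.coe_nonneg (h d hlt')] at hd
    exact ENNReal.zero_ne_top hd
  -- For the lower bound, one isometric copy of the graph, which has positive `μH[1]`, suffices.
  · obtain ⟨v, hv⟩ := isBesicovitchSetFor_range hp hq0 hq 0
    have hiso : Isometry fun z : ℂ => Complex.exp ((0 : ℝ) * Complex.I) * z + v :=
      Isometry.of_dist_eq fun z w => by simp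
    refine le_trans ?_ (dimH_mono hv)
    rw [hiso.dimH_image, planeGraphOn_eq_range hp hq0 hq]
    have := hausdorffMeasure_range_graphPoint_pos hp hq
    exact le_dimH_of_hausdorffMeasure_ne_zero (d := 1) (by simpa using this.ne')

end

/-! ### Choice of the parameters -/

/-- The dimension aimed at in stage `n`; it is positive and tends to `s`. -/
noncomputable def stageDim (s : ℝ) (n : ℕ) : ℝ := max s (1 / (n + 1))

/-- The exponent of the slope of stage `n`, when that stage starts at binary place `Q`. -/
noncomputable def slopeExponent (s : ℝ) (n Q : ℕ) : ℕ := n + ⌈(Q : ℝ) * (1 / stageDim s n - 1)⌉₊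

/-- The binary places where the stages start. -/
noncomputable def stageStart (s : ℝ) : ℕ → ℕ
  | 0 => 0
  | n + 1 => (n + 1) * (2 * slopeExponent s n (stageStart s n) + 2 * stageStart s n + n + 6)

/-- The exponents of the slopes of the stages. -/
noncomputable def stageExponent (s : ℝ) (n : ℕ) : ℕ := slopeExponent s n (stageStart s n)

section

variable {s : ℝ}

theorem stageDim_pos (n : ℕ) : 0 < stageDim s n := lt_max_of_lt_right (by positivity)

theorem stageDim_le_one (hs : s ≤ 1) (n : ℕ) : stageDim s n ≤ 1 :=
  max_le hs (by rw [div_le_one (by positivity)]; linarith [Nat.cast_nonneg (α := ℝ) n])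

theorem stageDim_antitone : Antitone (stageDim s) := fun m n h => by
  have : (m : ℝ) ≤ n := by exact_mod_cast h
  unfold stageDim
  gcongr

theorem one_div_stageDim_sub_nonneg (hs : s ≤ 1) (n : ℕ) : 0 ≤ 1 / stageDim s n - 1 := by
  rw [sub_nonneg, le_div_iff₀ (stageDim_pos n), one_mul]
  exact stageDim_le_one hs n

theorem stageStart_succ (n : ℕ) : stageStart s (n + 1) =
    (n + 1) * (2 * stageExponent s n + 2 * stageStart s n + n + 6) := by
  rw [stageStart, stageExponent]

theorem stageStart_strictMono : StrictMono (stageStart s) :=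
  strictMono_nat_of_lt_succ fun n => by
    rw [stageStart_succ]
    nlinarith [Nat.zero_le (stageExponent s n), Nat.zero_le (stageStart s n), Nat.zero_le n]

theorem sq_le_stageStart (n : ℕ) : n ^ 2 ≤ stageStart s n := by
  cases n with
  | zero => simp
  | succ n =>
    rw [stageStart_succ, sq]
    exact Nat.mul_le_mul_left _ (by omega)

theorem stageExponent_strictMono (hs : s ≤ 1) : StrictMono (stageExponent s) :=
  strictMono_nat_of_lt_succ fun n => by
    unfold stageExponent slopeExponent
    refine add_lt_add_of_lt_of_le n.lt_succ_self (Nat.ceil_le_ceil ?_)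
    have h1 : (stageStart s n : ℝ) ≤ stageStart s (n + 1) := by
      exact_mod_cast (stageStart_strictMono n.lt_succ_self).le
    have h2 := one_div_stageDim_sub_nonneg hs n
    have h3 := stageDim_pos (s := s) (n + 1)
    have h4 := stageDim_antitone (s := s) n.le_succ
    simp only [Nat.succ_eq_add_one] at h4
    gcongr

theorem le_stageExponent_add_stageStart (n : ℕ) :
    n + stageStart s n / stageDim s n ≤ (stageExponent s n : ℝ) + stageStart s n := by
  have := Nat.le_ceil ((stageStart s n : ℝ) * (1 / stageDim s n - 1))
  rw [mul_sub, mul_one, mul_one_div] at this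
  rw [stageExponent, slopeExponent]
  push_cast
  rw [mul_sub, mul_one, mul_one_div]
  linarith

theorem stageExponent_add_stageStart_le (hs : s ≤ 1) (n : ℕ) :
    (stageExponent s n : ℝ) + stageStart s n ≤ n + 1 + stageStart s n / stageDim s n := by
  have := Nat.ceil_lt_add_one (mul_nonneg (Nat.cast_nonneg (stageStart s n))
    (one_div_stageDim_sub_nonneg hs n))
  rw [mul_sub, mul_one, mul_one_div] at this
  rw [stageExponent, slopeExponent]
  push_cast
  rw [mul_sub, mul_one, mul_one_div]
  linarith

theorem tendsto_stageDim (hs : 0 ≤ s) : Tendsto (stageDim s) atTop (𝓝 s) := by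
  have h := (tendsto_const_nhds (x := s)).max tendsto_one_div_add_atTop_nhds_zero_nat
  rwa [max_eq_left hs] at h

/-- Once `stageDim s n < d`, the terms proportional to `stageStart s n` are nonpositive in total,
and the summand `n` of `slopeExponent` supplies the divergence `-d n`. -/
theorem tendsto_stageStart_sub (hs : 0 ≤ s) {d : ℝ} (hd : s < d) :
    Tendsto (fun n => (stageStart s n : ℝ) - d * (stageExponent s n + stageStart s n + 1))
      atTop atBot := by
  have hd0 : 0 < d := hs.trans_lt hd
  have hlim : Tendsto (fun n : ℕ => -(d * (n : ℝ))) atTop atBot :=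
    tendsto_neg_atTop_atBot.comp (tendsto_natCast_atTop_atTop.const_mul_atTop hd0)
  refine tendsto_atBot_mono' _ ?_ hlim
  filter_upwards [(tendsto_stageDim hs).eventually (gt_mem_nhds hd)] with n hn
  have h1 := le_stageExponent_add_stageStart (s := s) n
  have h2 : (stageStart s n : ℝ) ≤ d * (stageStart s n / stageDim s n) := by
    rw [← mul_div_assoc, le_div_iff₀ (stageDim_pos n), mul_comm]
    gcongr
  nlinarith

/-- With `c = 1 - d / s` the expression is at most `n + 1 - c * stageStart s n`, and `stageStart s n
≥ n²` bounds this by completing the square. -/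
theorem exists_bound_stageStart (hs : s ≤ 1) {d : ℝ} (hd0 : 0 < d) (hd : d < s) :
    ∃ M : ℝ, ∀ n, d * ((stageExponent s n : ℝ) + stageStart s n) - stageStart s n ≤ M := by
  have hs0 : 0 < s := hd0.trans hd
  set c := 1 - d / s with hc
  have hc0 : 0 < c := by rw [hc, sub_pos, div_lt_one hs0]; exact hd
  refine ⟨1 + 1 / (4 * c), fun n => ?_⟩
  have h1 := mul_le_mul_of_nonneg_left (stageExponent_add_stageStart_le hs n) hd0.le
  have h2 : (stageStart s n : ℝ) / stageDim s n ≤ stageStart s n / s := by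
    gcongr
    exact le_max_left _ _
  have h3 := mul_le_mul_of_nonneg_left h2 hd0.le
  have h4 : d * (stageStart s n / s) = (1 - c) * stageStart s n := by
    rw [hc]; field_simp; ring
  have h5 : (n : ℝ) ^ 2 ≤ stageStart s n := by exact_mod_cast sq_le_stageStart n
  have h6 := mul_le_mul_of_nonneg_left h5 hc0.le
  have h7 : d * ((n : ℝ) + 1) ≤ n + 1 := mul_le_of_le_one_left (by positivity) (by linarith)
  have h8 : 0 ≤ c * (n : ℝ) ^ 2 - n + 1 / (4 * c) := by
    have : c * (n : ℝ) ^ 2 - n + 1 / (4 * c) = (2 * c * n - 1) ^ 2 / (4 * c) := by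
      field_simp; ring
    rw [this]
    positivity
  linarith

/-- Here `stageStart s (n + 1) = (n + 1) A` with `A` equal to the rest of the counting exponent, so
the total is `3 d + A - (d - 1) (n + 1) A`. As soon as `(d - 1) (n + 1) ≥ 2` it is at most `3 d -
A`. -/
theorem tendsto_coveringExponent {d : ℝ} (hd : 1 < d) :
    Tendsto (fun n => (6 + 2 * stageExponent s n + 2 * stageStart s n + n +
      stageStart s (n + 1) : ℝ) + (3 - stageStart s (n + 1)) * d) atTop atBot := by
  have hlim : Tendsto (fun n : ℕ => 3 * d + -(n : ℝ)) atTop atBot :=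
    tendsto_atBot_add_const_left _ _ (tendsto_neg_atTop_atBot.comp tendsto_natCast_atTop_atTop)
  refine tendsto_atBot_mono' _ ?_ hlim
  obtain ⟨N, hN⟩ := exists_nat_ge (2 / (d - 1))
  filter_upwards [eventually_ge_atTop N] with n hn
  have hn' : (N : ℝ) ≤ n := by exact_mod_cast hn
  have h1 : 2 ≤ (d - 1) * (n + 1) := by
    rw [div_le_iff₀' (by linarith)] at hN
    nlinarith
  rw [stageStart_succ]
  push_cast
  set A : ℝ := 2 * stageExponent s n + 2 * stageStart s n + n + 6 with hA
  have hA0 : (n : ℝ) ≤ A := by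
    rw [hA]
    have h2 : (0 : ℝ) ≤ stageExponent s n := by positivity
    have h3 : (0 : ℝ) ≤ stageStart s n := by positivity
    linarith
  have h4 := mul_le_mul_of_nonneg_right h1 ((Nat.cast_nonneg n).trans hA0)
  linarith

end

theorem theorem1 (s : ℝ) (hs : s ∈ Set.Icc (0 : ℝ) 1) :
    ∃ (Γ : Set ℂ) (C : Set ℝ) (f : ℝ → ℝ),
      IsOneRectifiable Γ ∧
      0 < μH[1] Γ ∧
      (∃ B : Set ℂ, IsBesicovitchSetFor Γ B ∧ dimH B = 1) ∧
      IsCantorSet C ∧ volume C = 0 ∧ dimH C = ENNReal.ofReal s ∧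
      MonotoneOn f C ∧ Γ = planeGraphOn C f ∧
      (∀ᵐ p ∂(μH[1] : Measure ℂ), p ∈ Γ → IsApproxTangentLine Γ p verticalDirection) := by
  have hp := stageExponent_strictMono hs.2
  have hq := stageStart_strictMono (s := s)
  have hq0 : stageStart s 0 = 0 := rfl
  have hmono := monotoneOn_graphFun hp hq0 hq
  have hrange := planeGraphOn_eq_range hp hq0 hq
  have hvol := volume_cantorDomain hp hq
  refine ⟨planeGraphOn (cantorDomain (stageExponent s) (stageStart s))
    (graphFun (stageExponent s) (stageStart s)), _, _, planeGraphOn.isOneRectifiable hmono, ?_,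
    ⟨_, isBesicovitchSetFor_range hp hq0 hq, dimH_range_besicovitchPoint hp hq0 hq fun d hd =>
      tendsto_coveringExponent hd⟩, isCantorSet_cantorDomain hp hq0 hq, hvol,
    dimH_cantorDomain hp hq0 hq hs.2 (fun d hd => tendsto_stageStart_sub hs.1 hd)
      (fun d hd0 hd => exists_bound_stageStart hs.2 hd0 hd), hmono, rfl,
    planeGraphOn.ae_isApproxTangentLine hmono hvol ?_⟩
  · rw [hrange]
    exact hausdorffMeasure_range_graphPoint_pos hp hq
  · rw [hrange]
    exact isCompact_range (continuous_graphPoint hq)
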